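/- Write $[g,h]=g^{-1}h^{-1}gh$. Let $c\ge 5$ be an integer. For $\alpha\in\{0,1\}$ and $\beta\in\{0,1,2\}$ let $G_c(\alpha,\beta)$ be the group with generators $x,y,t_3,s_2,s_3,\ldots,s_c$ and power-commutator presentation $$s_2=[y,x],\quad t_3=[s_2,y],\quad s_j=[s_{j-1},x]\ (3\le j\le c),$$ $$s_j^3=s_{j+2}^2s_{j+3}\ (2\le j\le c-3),\quad s_{c-2}^3=s_c^2,\quad t_3^3=1,\quad R(x)=1,\quad R(y)=1,$$ where $$R(x)=x^3s_c^{-\alpha},\qquad R(y)=y^3s_3^{-2}s_4^{-1}s_c^{-\beta},$$ and where, as usual in power-commutator presentations, the third powers and the commutators of generators that are not listed are trivial ($s_{c-1}^3=s_c^3=1$, $[s_c,x]=[t_3,x]=[t_3,y]=1$, $[s_j,y]=1$ for $j\ge 3$, and the $s_j$ and $t_3$ commute with one another). Let $\langle 243,6\rangle$ be the group of order $3^5$ with power-commutator presentation $$\langle x,y,s_2,s_3,t_3\mid s_2=[y,x],\ s_3=[s_2,x],\ t_3=[s_2,y],\ x^3=1,\ y^3=s_3^2,\ s_2^3=s_3^3=t_3^3=1\rangle$$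 (unlisted commutators being trivial). A group $G$ is a descendant of $R$ if $R$ is isomorphic to the quotient of $G$ by a term of its lower central series. It is metabelian if its soluble length is $2$. For a group $G$ with exactly four subgroups $H_1,\ldots,H_4$ of index $3$, the transfer kernel type (TKT) is $\varkappa=(\varkappa_1,\ldots,\varkappa_4)$, up to renumbering of the $H_i$, where $\varkappa_i=0$ if the Artin transfer $T_i:G/G'\to H_i/H_i'$ is trivial, and $\varkappa_i=j$ if $\ker T_i=H_j/G'$. The types are c.18: $(0122)$, E.6: $(1122)$, H.4: $(2122)$, E.14: $(3122)$. A finite $3$-group $G$ is called a $\sigma$-group if it has an automorphism of order $2$ that acts as inversion on $H^1(G,\mathbb{F}_3)=\mathrm{Hom}(G,\mathbb{F}_3)$. Then the following holds for every $c\ge 5$. 1. Each of the six groups $G=G_c(\alpha,\beta)$ is a metabelian descendant of $\langle 243,6\rangle$ of order $3^{c+2}$, nilpotency class $c$ and coclass $2$; it is generated by $x$ and $y$, and $t_3$ and all $s_j$ lie in the abelian subgroup $G'$. Its TKT is c.18 if $(\alpha,\beta)=(0,0)$, E.6 if $(\alpha,\beta)=(1,0)$, H.4 if $\alpha=0$,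 $\beta\ne 0$, and E.14 if $\alpha=1$, $\beta\neq 0$. 2. The groups $G_c(0,0)$ form the mainline: $G_c(0,0)$ is isomorphic to the quotient of $G_{c+1}(0,0)$ by $\gamma_{c+1}(G_{c+1}(0,0))$, the last non-trivial term of its lower central series. 3. If $c$ is odd, then the six groups $G_c(\alpha,\beta)$ are pairwise non-isomorphic $\sigma$-groups. 4. If $c$ is even, then two of the groups $G_c(\alpha,\beta)$, $G_c(\alpha',\beta')$ are isomorphic if and only if they are assigned the same TKT in 1.; that is, $G_c(0,1)\simeq G_c(0,2)$ (type H.4) and $G_c(1,1)\simeq G_c(1,2)$ (type E.14), and there are exactly four groups up to isomorphism. Among them only the mainline group $G_c(0,0)$ is a $\sigma$-group. -/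

import Mathlib

namespace QTree

/-- The commutator `[g, h] = g⁻¹ h⁻¹ g h`, the convention of power-commutator presentations
(so that `h⁻¹ g h = g [g, h]`). -/
def comm {G : Type*} [Group G] (g h : G) : G := g⁻¹ * h⁻¹ * g * h

/-! ### The group `⟨243, 6⟩` -/

/-- The five generators of the pc-presentation of `SmallGroup(243, 6)`. -/
inductive RootGen
  | x | y | s₂ | s₃ | t₃

/-- The relations `l = r` of the pc-presentation of `SmallGroup(243, 6)`, a group of order `3 ^ 5`
and nilpotency class `3`. The last seven are the commutator relations with trivial right-hand
side which a pc-presentation leaves unwritten. -/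
inductive RootEq : FreeGroup RootGen → FreeGroup RootGen → Prop
  | def_s₂ : RootEq (.of .s₂) (comm (.of .y) (.of .x))
  | def_s₃ : RootEq (.of .s₃) (comm (.of .s₂) (.of .x))
  | def_t₃ : RootEq (.of .t₃) (comm (.of .s₂) (.of .y))
  | pow_x : RootEq (.of .x ^ 3) 1
  | pow_y : RootEq (.of .y ^ 3) (.of .s₃ ^ 2)
  | pow_s₂ : RootEq (.of .s₂ ^ 3) 1
  | pow_s₃ : RootEq (.of .s₃ ^ 3) 1
  | pow_t₃ : RootEq (.of .t₃ ^ 3) 1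
  | comm_s₃_x : RootEq (comm (.of .s₃) (.of .x)) 1
  | comm_s₃_y : RootEq (comm (.of .s₃) (.of .y)) 1
  | comm_t₃_x : RootEq (comm (.of .t₃) (.of .x)) 1
  | comm_t₃_y : RootEq (comm (.of .t₃) (.of .y)) 1
  | comm_s₃_s₂ : RootEq (comm (.of .s₃) (.of .s₂)) 1
  | comm_t₃_s₂ : RootEq (comm (.of .t₃) (.of .s₂)) 1
  | comm_t₃_s₃ : RootEq (comm (.of .t₃) (.of .s₃)) 1

/-- The group `SmallGroup(243, 6)`. -/
abbrev Root : Type := PresentedGroup {w : FreeGroup RootGen | ∃ l r, RootEq l r ∧ w = l * r⁻¹}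

/-! ### The parametrized pc-presentation -/

/-- The generators `x, y, t₃` and `s_j` with `2 ≤ j ≤ c`. -/
inductive Gen (c : ℕ)
  | x | y | t₃
  | s (j : ℕ) (two_le : 2 ≤ j) (le_c : j ≤ c)

section words

variable (c : ℕ)

/-- The generator `x`, as a word. -/
def wx : FreeGroup (Gen c) := .of .x

/-- The generator `y`, as a word. -/
def wy : FreeGroup (Gen c) := .of .y

/-- The generator `t₃`, as a word. -/
def wt : FreeGroup (Gen c) := .of .t₃

/-- The generator `s_j`, as a word, for `2 ≤ j ≤ c` (only such `j` occur in the relations). -/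
def ws (j : ℕ) : FreeGroup (Gen c) := if h : 2 ≤ j ∧ j ≤ c then .of (.s j h.1 h.2) else 1

end words

/-- The relations `l = r` of the pc-presentation with parameters `α ∈ {0, 1}`, `β ∈ {0, 1, 2}`:
the displayed ones up to `rel_y`, then the power and commutator relations with trivial
right-hand side which a pc-presentation leaves unwritten. -/
inductive PcEq (c : ℕ) (α : Fin 2) (β : Fin 3) : FreeGroup (Gen c) → FreeGroup (Gen c) → Prop
  | def_s₂ : PcEq c α β (ws c 2) (comm (wy c) (wx c))
  | def_t₃ : PcEq c α β (wt c) (comm (ws c 2) (wy c))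
  | def_s (j : ℕ) (h₁ : 3 ≤ j) (h₂ : j ≤ c) : PcEq c α β (ws c j) (comm (ws c (j - 1)) (wx c))
  | pow_s (j : ℕ) (h₁ : 2 ≤ j) (h₂ : j + 3 ≤ c) :
      PcEq c α β (ws c j ^ 3) (ws c (j + 2) ^ 2 * ws c (j + 3))
  | pow_s_antepenult : PcEq c α β (ws c (c - 2) ^ 3) (ws c c ^ 2)
  | pow_t₃ : PcEq c α β (wt c ^ 3) 1
  | rel_x : PcEq c α β (wx c ^ 3) (ws c c ^ (α : ℕ))
  | rel_y : PcEq c α β (wy c ^ 3) (ws c c ^ (β : ℕ) * ws c 4 * ws c 3 ^ 2)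
  | pow_s_penult : PcEq c α β (ws c (c - 1) ^ 3) 1
  | pow_s_last : PcEq c α β (ws c c ^ 3) 1
  | comm_s_last_x : PcEq c α β (comm (ws c c) (wx c)) 1
  | comm_s_y (j : ℕ) (h₁ : 3 ≤ j) (h₂ : j ≤ c) : PcEq c α β (comm (ws c j) (wy c)) 1
  | comm_t₃_x : PcEq c α β (comm (wt c) (wx c)) 1
  | comm_t₃_y : PcEq c α β (comm (wt c) (wy c)) 1
  | comm_s_s (i j : ℕ) (hi₁ : 2 ≤ i) (hi₂ : i ≤ c) (hj₁ : 2 ≤ j) (hj₂ : j ≤ c) :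
      PcEq c α β (comm (ws c i) (ws c j)) 1
  | comm_s_t₃ (j : ℕ) (h₁ : 2 ≤ j) (h₂ : j ≤ c) : PcEq c α β (comm (ws c j) (wt c)) 1

/-- The relators `l r⁻¹`; in particular `R(x) = x³ s_c^{-α}` and
`R(y) = y³ s₃⁻² s₄⁻¹ s_c^{-β}`. -/
def relators (c : ℕ) (α : Fin 2) (β : Fin 3) : Set (FreeGroup (Gen c)) :=
  {w | ∃ l r, PcEq c α β l r ∧ w = l * r⁻¹}

/-- The group `G_c(α, β)` given by the parametrized pc-presentation. -/
abbrev QGroup (c : ℕ) (α : Fin 2) (β : Fin 3) : Type := PresentedGroup (relators c α β)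

/-- The element of `G_c(α, β)` that a word represents. -/
def QGroup.mk {c : ℕ} (α : Fin 2) (β : Fin 3) (w : FreeGroup (Gen c)) : QGroup c α β :=
  PresentedGroup.mk (relators c α β) w

/-! ### Group theoretic notions -/

/-- Soluble length exactly `2`. -/
def IsMetabelian (G : Type*) [Group G] : Prop :=
  derivedSeries G 1 ≠ ⊥ ∧ derivedSeries G 2 = ⊥

/-- `G` is nilpotent of class exactly `c`; the class is the length of the central series. -/
def HasClass (G : Type*) [Group G] (c : ℕ) : Prop :=
  ∃ _ : Group.IsNilpotent G, Group.nilpotencyClass G = c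

/-- `G` is a finite `p`-group of order `p ^ n`, class `c` and coclass `n - c = r`. -/
def HasCoclass (p : ℕ) (G : Type*) [Group G] (r : ℕ) : Prop :=
  ∃ n c : ℕ, Nat.card G = p ^ n ∧ HasClass G c ∧ n = c + r

/-- `G` is a descendant of `R`: iterating the passage from a group to its parent, the quotient by
the last non-trivial term of its lower central series, one gets from `G` to `R`; that is, `R` is
a quotient of `G` by a term of the lower central series of `G` (in Mathlib's indexing,
`(⊤ : Subgroup G).lowerCentralSeries n` is `γ_{n+1}(G)`). -/
def IsDescendant (G R : Type*) [Group G] [Group R] : Prop :=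
  ∃ n : ℕ, Nonempty (G ⧸ (⊤ : Subgroup G).lowerCentralSeries n ≃* R)

/-- The kernel, as a subgroup of `G` (containing `G'`), of the Artin transfer `G → H/H'`. -/
noncomputable def transferKernel {G : Type*} [Group G] (H : Subgroup G) [H.FiniteIndex] :
    Subgroup G :=
  (MonoidHom.transfer (Abelianization.of : H →* Abelianization H)).ker

/-- `G` has exactly four subgroups of index `3`, and for a suitable numbering `H₁, …, H₄` of them
its transfer kernel type is `(κ₁, …, κ₄)`, where `κ_i = 0` means that the transfer to `H_i` is
trivial and `κ_i = j` that its kernel is `H_j`. -/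
def HasTKT (G : Type*) [Group G] (κ : Fin 4 → Fin 5) : Prop :=
  ∃ H : Fin 4 → Subgroup G, Function.Injective H ∧ Set.range H = {K | K.index = 3} ∧
    ∀ i, ∃ _ : (H i).FiniteIndex,
      transferKernel (H i) = (Fin.cons ⊤ H : Fin 5 → Subgroup G) (κ i)

/-- The type c.18. -/
def c18 : Fin 4 → Fin 5 := ![0, 1, 2, 2]

/-- The type E.6. -/
def E6 : Fin 4 → Fin 5 := ![1, 1, 2, 2]

/-- The type H.4. -/
def H4 : Fin 4 → Fin 5 := ![2, 1, 2, 2]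

/-- The type E.14. -/
def E14 : Fin 4 → Fin 5 := ![3, 1, 2, 2]

/-- The transfer kernel type attached to the parameters. -/
def tkt (α : Fin 2) (β : Fin 3) : Fin 4 → Fin 5 :=
  if α = 0 then (if β = 0 then c18 else H4) else (if β = 0 then E6 else E14)

/-- `G` is a `σ`-group (for the prime `3`): it has an automorphism of order `2` that acts as
inversion on `H¹(G, 𝔽₃) = Hom(G, 𝔽₃)`. -/
def IsSigmaGroup (G : Type*) [Group G] : Prop :=
  ∃ σ : MulAut G, orderOf σ = 2 ∧
    ∀ (f : G →* Multiplicative (ZMod 3)) (g : G), f (σ g) = (f g)⁻¹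

end QTree

/-!
The group `G_c(α, β)` is compared with a model of known order. Let `R` be the quotient of the
Eisenstein integers by the `c`-th power of the prime `λ = ζ - 1`, and let `X = λ - β λ ^ (c - 2)`,
a uniformizer with `X ^ 2 + 3 X + 3 = β X ^ (c - 1)` (`eisUniserial`). The model consists of the
triples `(i, u, t)` in `𝔽₃ × R × 𝔽₃`: the pairs `(u, t)` form a Heisenberg group, and `x = (1, 0, 0)`
acts on `R` as multiplication by `1 + X`, with `x ^ 3 = (0, α X ^ (c - 1), 0)`. Commutation with `x`
is then multiplication by `X`, so that with `y = (0, 1, 0)` one gets `s_j = (0, X ^ (j - 1), 0)` for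
`j ≥ 3`, and the power relations of the presentation come from the quadratic equation for `X`; this
is where `β` enters. The homomorphism from `G_c(α, β)` to the model is onto, and the presentation
bounds the order of `G_c(α, β)` by `3 ^ (c + 2)`, the order of the model; hence
`QGroup.equivModel`.

The relations are handled in the form of a `PcSystem`, a family of elements satisfying them in some
group. Systems can be truncated, so the same argument identifies the quotients by terms of the
lower central series, which gives the mainline and the descent from `⟨243, 6⟩`.

For the isomorphism problem, systems in the model are determined. If a system for `(α', β')`
generates the model for `(α, β)`, then its first element is `(a, w, r)` with `a ≠ 0` and its second
element is `(0, v, r')` with `v` a unit, and comparing the cubes gives `α' a ^ (c - 1) v = a α` and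
`β = β' a ^ (c - 1)` in `𝔽₃` (`Model.generating_conditions`). Conversely, these conditions suffice
for some such system to exist (`Model.sys`). As `a = ± 1`, everything depends on the parity of `c`.

For the transfer to a maximal subgroup `H`, which is normal of index `3`, the image of `h ∉ H` is
`h ^ 3`, and that of `g ∈ H` is the product of the three conjugates of `g`. The images of `x` and `y`
turn out to be powers of one element of order `3` in `H/H'`, and the exponents determine the kernel.
With `H₁ = ⟨y, G'⟩`, `H₂ = ⟨x, G'⟩` and the two remaining subgroups `H₃` and `H₄`, the kernels are
`{α i + β j = 0}` for `H₁`, where `i` and `j` are the exponents of `x` and `y` modulo `G'`, `H₁` for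
`H₂`, and `H₂` for `H₃` and `H₄`.
-/

namespace QTree

/-! ### The uniserial coefficient rings -/

/-- A commutative ring `R` of order `3 ^ c` which is a quotient of the Eisenstein integers by a
power of the prime above `3`, with a uniformizer `X` such that `X² + 3X + 3 = β X ^ (c - 1)`.
The maps `p₀` and `p₁` are the first two coefficients, modulo `3`, of the `X`-adic expansion. -/
structure Uniserial (c β : ℕ) (R : Type*) [CommRing R] where
  five_le : 5 ≤ c
  X : R
  p₀ : R →+* ZMod 3
  p₁ : R →+ ZMod 3
  p₁_mul (u v : R) : p₁ (u * v) = p₀ u * p₁ v + p₁ u * p₀ v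
  p₀_X : p₀ X = 0
  p₁_X : p₁ X = 1
  quad : X ^ 2 + 3 * X + 3 = β * X ^ (c - 1)
  X_pow : X ^ c = 0
  X_pow_pred : X ^ (c - 1) ≠ 0
  card_eq : Nat.card R = 3 ^ c
  eq_top (S : AddSubgroup R) (h1 : 1 ∈ S) (hX : ∀ u ∈ S, X * u ∈ S) : S = ⊤

section construction

open QuadraticAlgebra

/-- The Eisenstein integers `ℤ[ζ]`, with basis `1` and `ζ - 1`. -/
abbrev Eis : Type := QuadraticAlgebra ℤ (-3) (-3)

/-- The prime element `ζ - 1` above `3`. -/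
def lam : Eis := ⟨0, 1⟩

/-- Reduction modulo `ζ - 1`. -/
def eisRes : Eis →+* ZMod 3 where
  toFun u := (u.re : ZMod 3)
  map_one' := by simp
  map_mul' u v := by
    have h : (3 : ZMod 3) = 0 := rfl
    simp [h]
  map_zero' := by simp
  map_add' u v := by simp

/-- The coefficient of `ζ - 1`, modulo `3`. -/
def eisRes₁ : Eis →+ ZMod 3 where
  toFun u := (u.im : ZMod 3)
  map_zero' := by simp
  map_add' u v := by simp

theorem eisRes₁_mul (u v : Eis) :
    eisRes₁ (u * v) = eisRes u * eisRes₁ v + eisRes₁ u * eisRes v := by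
  have h : (3 : ZMod 3) = 0 := rfl
  simp [eisRes, eisRes₁, h]

theorem eisRes_lam : eisRes lam = 0 := by simp [eisRes, lam]

theorem eisRes₁_lam : eisRes₁ lam = 1 := by simp [eisRes₁, lam]

theorem lam_sq : lam ^ 2 + 3 * lam + 3 = 0 := by
  ext <;> simp [lam, sq]

theorem eis_eq (u : Eis) : u = (u.re : Eis) + (u.im : Eis) * lam := by
  ext <;> simp [lam]

theorem lam_mul_cancel {u v : Eis} (h : lam * u = lam * v) : u = v := by
  have h3 : lam * (lam + 3) = -3 := by linear_combination lam_sq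
  have h' : (-3 : Eis) * u = (-3) * v := by
    rw [← h3]
    linear_combination (lam + 3) * h
  have hre := congrArg QuadraticAlgebra.re h'
  have him := congrArg QuadraticAlgebra.im h'
  simp at hre him
  ext <;> omega

theorem lam_dvd_iff (u : Eis) : lam ∣ u ↔ eisRes u = 0 := by
  constructor
  · rintro ⟨v, rfl⟩
    rw [map_mul, eisRes_lam, zero_mul]
  · intro h
    have h3 : lam * (lam + 3) = -3 := by linear_combination lam_sq
    obtain ⟨k, hk⟩ := (ZMod.intCast_zmod_eq_zero_iff_dvd u.re 3).1 h
    rw [eis_eq u, hk]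
    push_cast
    exact ⟨-((lam + 3) * k) + u.im, by linear_combination (k : Eis) * h3⟩

theorem lam_pow_mul_cancel (n : ℕ) {u v : Eis} (h : lam ^ n * u = lam ^ n * v) : u = v := by
  induction n with
  | zero => simpa using h
  | succ n ih => exact ih (lam_mul_cancel (by rw [pow_succ'] at h; simpa [mul_assoc] using h))

/-- The quotient of the Eisenstein integers by the `c`-th power of the prime above `3`. -/
abbrev EisQuot (c : ℕ) : Type := Eis ⧸ Ideal.span {lam ^ c}

theorem index_span_lam_pow (n : ℕ) :
    (Ideal.span {lam ^ n}).toAddSubgroup.index = 3 ^ n := by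
  induction n with
  | zero => simp [Ideal.span_singleton_one]
  | succ n ih =>
    let f : Eis →+ Eis := AddMonoidHom.mulLeft (lam ^ n)
    have hf : Function.Injective f := fun u v h => lam_pow_mul_cancel n h
    have e1 : (Ideal.span {lam ^ n}).toAddSubgroup = (⊤ : AddSubgroup Eis).map f := by
      ext u
      simp [f, Ideal.mem_span_singleton, dvd_def, eq_comm]
    have e2 : (Ideal.span {lam ^ (n + 1)}).toAddSubgroup
        = (eisRes : Eis →+ ZMod 3).ker.map f := by
      ext u
      simp only [Submodule.mem_toAddSubgroup, Ideal.mem_span_singleton, AddSubgroup.mem_map,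
        AddMonoidHom.mem_ker, AddMonoidHom.coe_coe, ← lam_dvd_iff, f, AddMonoidHom.coe_mulLeft]
      constructor
      · rintro ⟨v, rfl⟩
        exact ⟨lam * v, ⟨v, rfl⟩, by ring⟩
      · rintro ⟨_, ⟨v, rfl⟩, rfl⟩
        exact ⟨v, by ring⟩
    have hk : (eisRes : Eis →+ ZMod 3).ker.index = 3 := by
      rw [AddSubgroup.index_ker, AddMonoidHom.range_eq_top.2]
      · simp
      · intro a
        exact ⟨((a.val : ℤ) : Eis), by simp⟩
    rw [← AddSubgroup.relIndex_mul_index (K := (Ideal.span {lam ^ n}).toAddSubgroup), ih, e2, e1,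
      AddSubgroup.relIndex_map_map_of_injective _ _ hf, AddSubgroup.relIndex_top_right, hk, pow_succ']
    rw [e2, e1]
    exact AddSubgroup.map_mono le_top

theorem perturb_pow {A : Type*} [CommRing A] {L b : A} {m : ℕ} (hL : L ^ (m + 5) = 0) {n : ℕ}
    (hn : 3 ≤ n) : (L - b * L ^ (m + 3)) ^ n = L ^ n := by
  obtain ⟨k, rfl⟩ := Nat.exists_eq_add_of_le' hn
  have key (j : ℕ) : L ^ 3 * (1 - b * L ^ (m + 2)) ^ j = L ^ 3 := by
    induction j with
    | zero => simp
    | succ j ih =>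
      rw [pow_succ _ j, ← mul_assoc, ih]
      linear_combination - b * hL
  rw [show L - b * L ^ (m + 3) = L * (1 - b * L ^ (m + 2)) by ring, mul_pow, pow_add, mul_assoc,
    key]

theorem perturb_quad {A : Type*} [CommRing A] {L b : A} {m : ℕ} (hL : L ^ (m + 5) = 0)
    (hq : L ^ 2 + 3 * L + 3 = 0) :
    (L - b * L ^ (m + 3)) ^ 2 + 3 * (L - b * L ^ (m + 3)) + 3 = b * L ^ (m + 4) := by
  linear_combination (1 - b * L ^ (m + 3)) * hq + (b + b ^ 2 * L ^ (m + 1)) * hL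

/-- The quotient of the Eisenstein integers by `λ ^ c` contains, for every `β`, a uniformizer
with `X² + 3X + 3 = β X ^ (c - 1)`: the perturbation `X = λ - β λ ^ (c - 2)` of `λ`. -/
noncomputable def eisUniserial (c β : ℕ) (hc : 5 ≤ c) : Uniserial c β (EisQuot c) :=
  let L : EisQuot c := Ideal.Quotient.mk _ lam
  have hL : L ^ c = 0 := by
    rw [← map_pow]
    exact Ideal.Quotient.eq_zero_iff_mem.2 (Ideal.mem_span_singleton_self _)
  have hq : L ^ 2 + 3 * L + 3 = 0 := by
    have := congrArg (Ideal.Quotient.mk (Ideal.span {lam ^ c})) lam_sq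
    simpa only [map_add, map_mul, map_pow, map_ofNat, map_zero] using this
  have hX (n : ℕ) (hn : 3 ≤ n) : (L - β * L ^ (c - 2)) ^ n = L ^ n := by
    have e : c - 2 = (c - 5) + 3 := by omega
    rw [e]
    exact perturb_pow (by rwa [Nat.sub_add_cancel hc]) hn
  have h1 (k n : ℕ) (hk : k < c) (hn : eisRes n ≠ 0) : lam ^ c ∣ n * lam ^ k → False := by
    rintro ⟨v, hv⟩
    refine hn ((lam_dvd_iff _).1 ⟨lam ^ (c - k - 1) * v, lam_pow_mul_cancel k ?_⟩)
    rw [mul_comm, hv, ← mul_assoc, ← mul_assoc, ← pow_succ, ← pow_add]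
    congr 2
    omega
  have hz₀ (u : Eis) (hu : u ∈ Ideal.span {lam ^ c}) : eisRes u = 0 := by
    obtain ⟨v, rfl⟩ := Ideal.mem_span_singleton.1 hu
    rw [map_mul, map_pow, eisRes_lam, zero_pow (by omega), zero_mul]
  have hz₁ (u : Eis) (hu : u ∈ Ideal.span {lam ^ c}) : eisRes₁ u = 0 := by
    obtain ⟨v, rfl⟩ := Ideal.mem_span_singleton.1 hu
    rw [show c = (c - 2) + 1 + 1 by omega, pow_succ, pow_succ, mul_assoc, mul_assoc]
    simp [eisRes₁_mul, eisRes_lam]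
  let p₀ : EisQuot c →+* ZMod 3 := Ideal.Quotient.lift _ eisRes hz₀
  let p₁ : EisQuot c →+ ZMod 3 :=
    QuotientAddGroup.lift (Ideal.span {lam ^ c}).toAddSubgroup eisRes₁ hz₁
  have p₁_mul (u v : EisQuot c) : p₁ (u * v) = p₀ u * p₁ v + p₁ u * p₀ v := by
    obtain ⟨u, rfl⟩ := Ideal.Quotient.mk_surjective u
    obtain ⟨v, rfl⟩ := Ideal.Quotient.mk_surjective v
    exact eisRes₁_mul u v
  have p₀_L : p₀ L = 0 := eisRes_lam
  have p₁_L : p₁ L = 1 := eisRes₁_lam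
  { five_le := hc
    X := L - β * L ^ (c - 2)
    p₀ := p₀
    p₁ := p₁
    p₁_mul := p₁_mul
    p₀_X := by
      rw [map_sub, map_mul, map_pow, p₀_L, zero_pow (by omega), mul_zero, sub_zero]
    p₁_X := by
      rw [map_sub, show c - 2 = (c - 4) + 1 + 1 by omega, pow_succ, pow_succ]
      simp [p₁_mul, p₀_L, p₁_L]
    quad := by
      have e₁ : c - 1 = (c - 5) + 4 := by omega
      have e₂ : c - 2 = (c - 5) + 3 := by omega
      rw [hX (c - 1) (by omega), e₁, e₂]
      exact perturb_quad (by rwa [Nat.sub_add_cancel hc]) hq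
    X_pow := by rw [hX _ (by omega), hL]
    X_pow_pred := by
      rw [hX _ (by omega), ← map_pow, Ne, Ideal.Quotient.eq_zero_iff_mem,
        Ideal.mem_span_singleton]
      intro h
      exact h1 (c - 1) 1 (by omega) (by simp) (by simpa using h)
    card_eq := by
      rw [← index_span_lam_pow c]
      rfl
    eq_top := by
      intro S h1 hX'
      have hpow (n : ℕ) : (L - β * L ^ (c - 2)) ^ n ∈ S := by
        induction n with
        | zero => simpa using h1
        | succ n ih => rw [pow_succ']; exact hX' _ ih
      have hlam : L ∈ S := by
        have h2 := S.add_mem (hpow 1) (S.nsmul_mem (hpow (c - 2)) β)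
        rw [hX (c - 2) (by omega), nsmul_eq_mul] at h2
        simpa using h2
      rw [eq_top_iff]
      rintro u -
      obtain ⟨u, rfl⟩ := Ideal.Quotient.mk_surjective u
      rw [eis_eq u, map_add, map_mul, map_intCast, map_intCast]
      refine S.add_mem ?_ ?_
      · simpa using S.zsmul_mem h1 u.re
      · simpa using S.zsmul_mem hlam u.im }

end construction

namespace Uniserial

variable {c β : ℕ} {R : Type*} [CommRing R] (D : Uniserial c β R)

include D

theorem three_mul_X_pow : 3 * D.X ^ (c - 1) = 0 := by
  obtain ⟨m, rfl⟩ := Nat.exists_eq_add_of_le' D.five_le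
  have h := D.X_pow
  have hq := D.quad
  rw [show m + 5 - 1 = m + 4 by omega] at *
  linear_combination D.X ^ (m + 4) * hq + (β * D.X ^ (m + 3) - D.X - 3) * h

theorem X_mul_X_pow : D.X * D.X ^ (c - 1) = 0 := by
  have hc := D.five_le
  rw [← pow_succ', Nat.sub_add_cancel (by omega), D.X_pow]

/-- The `X`-adic digit expansion of an element, up to its first digit. -/
theorem exists_eq (u : R) : ∃ (n : ℤ) (r : R), u = n + D.X * r := by
  let S : AddSubgroup R :=
    { carrier := {u | ∃ (n : ℤ) (r : R), u = n + D.X * r}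
      zero_mem' := ⟨0, 0, by simp⟩
      add_mem' := by
        rintro _ _ ⟨n, r, rfl⟩ ⟨m, s, rfl⟩
        exact ⟨n + m, r + s, by push_cast; ring⟩
      neg_mem' := by
        rintro _ ⟨n, r, rfl⟩
        exact ⟨-n, -r, by push_cast; ring⟩ }
  have hS : S = ⊤ := D.eq_top S ⟨1, 0, by simp⟩ fun u _ => ⟨0, u, by simp⟩
  exact (hS ▸ AddSubgroup.mem_top u : u ∈ S)

theorem int_mul_X_pow (n : ℤ) : (n : R) * D.X ^ (c - 1) = 0 ↔ (n : ZMod 3) = 0 := by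
  rw [ZMod.intCast_zmod_eq_zero_iff_dvd]
  have h3 := D.three_mul_X_pow
  have h1 := D.X_pow_pred
  constructor
  · intro h
    by_contra hn
    have hm : n % 3 = 1 ∨ n % 3 = 2 := by omega
    have hd : n = 3 * (n / 3) + n % 3 := by omega
    rcases hm with hm | hm
    · rw [hm] at hd
      rw [hd] at h
      push_cast at h
      exact h1 (by linear_combination h - ((n / 3 : ℤ) : R) * h3)
    · rw [hm] at hd
      rw [hd] at h
      push_cast at h
      exact h1 (by linear_combination (((n / 3 : ℤ) : R) + 1) * h3 - h)
  · rintro ⟨k, rfl⟩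
    push_cast
    linear_combination (k : R) * h3

theorem mul_X_pow (u : R) {n : ℤ} (hn : (n : ZMod 3) = D.p₀ u) :
    u * D.X ^ (c - 1) = n * D.X ^ (c - 1) := by
  obtain ⟨m, r, rfl⟩ := D.exists_eq u
  have h : ((n - m : ℤ) : R) * D.X ^ (c - 1) = 0 := by
    rw [D.int_mul_X_pow]
    simp [hn, D.p₀_X]
  push_cast at h
  linear_combination r * D.X_mul_X_pow - h

theorem mul_X_pow_eq_zero {u : R} (hu : D.p₀ u = 0) : u * D.X ^ (c - 1) = 0 := by
  rw [D.mul_X_pow u (n := 0) (by simp [hu])]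
  simp

theorem exists_X_mul {u : R} (hu : D.p₀ u = 0) : ∃ r, u = D.X * r := by
  obtain ⟨n, r, rfl⟩ := D.exists_eq u
  have hn : (n : ZMod 3) = 0 := by simpa [D.p₀_X] using hu
  obtain ⟨k, rfl⟩ := (ZMod.intCast_zmod_eq_zero_iff_dvd n 3).1 hn
  obtain ⟨m, rfl⟩ := Nat.exists_eq_add_of_le' D.five_le
  have hq := D.quad
  rw [show m + 5 - 1 = m + 3 + 1 by omega] at hq
  refine ⟨r + k * (β * D.X ^ (m + 3) - D.X - 3), ?_⟩
  push_cast
  linear_combination (k : R) * hq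

/-- The alternating form `R/X² × R/X² → 𝔽₃` which is the commutator pairing of the maximal
subgroup `⟨y, G'⟩`. -/
def ω (u v : R) : ZMod 3 := D.p₁ u * D.p₀ v - D.p₀ u * D.p₁ v

/-- The power `(1 + X) ^ i` for `i` modulo `3`. -/
def z (i : ZMod 3) : R := (1 + D.X) ^ i.val

theorem z_zero : D.z 0 = 1 := by simp [z]
theorem z_one : D.z 1 = 1 + D.X := by simp [z, ZMod.val_one]
theorem z_two : D.z 2 = (1 + D.X) ^ 2 := rfl

theorem X_add_one_pow : (1 + D.X) ^ 3 = 1 := by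
  linear_combination D.X * D.quad + β * D.X_mul_X_pow

theorem z_add (i j : ZMod 3) : D.z (i + j) = D.z i * D.z j := by
  rw [z, z, z, ← pow_add, ZMod.val_add]
  exact (pow_eq_pow_mod _ D.X_add_one_pow).symm

theorem p₀_z (i : ZMod 3) : D.p₀ (D.z i) = 1 := by simp [z, D.p₀_X]

theorem p₁_one : D.p₁ 1 = 0 := by
  have h := D.p₁_mul 1 1
  simpa using h

theorem p₁_z (i : ZMod 3) : D.p₁ (D.z i) = i := by
  fin_cases i
  · exact (congrArg _ D.z_zero).trans D.p₁_one
  · refine (congrArg _ D.z_one).trans ?_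
    rw [map_add, D.p₁_one, D.p₁_X]
    rfl
  · refine (congrArg _ D.z_two).trans ?_
    rw [sq, D.p₁_mul]
    simp only [map_add, map_one, D.p₁_one, D.p₁_X, D.p₀_X]
    change _ = (2 : ZMod 3)
    norm_num

theorem p₀_X_pow {n : ℕ} (hn : n ≠ 0) : D.p₀ (D.X ^ n) = 0 := by
  rw [map_pow, D.p₀_X, zero_pow hn]

theorem p₁_X_pow {n : ℕ} (hn : 2 ≤ n) : D.p₁ (D.X ^ n) = 0 := by
  obtain ⟨m, rfl⟩ := Nat.exists_eq_add_of_le' hn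
  rw [pow_succ, p₁_mul, p₀_X_pow _ (by omega), p₀_X]
  simp

theorem p₀_X_pow_pred : D.p₀ (D.X ^ (c - 1)) = 0 :=
  D.p₀_X_pow (by have := D.five_le; omega)

theorem p₁_X_pow_pred : D.p₁ (D.X ^ (c - 1)) = 0 :=
  D.p₁_X_pow (by have := D.five_le; omega)

theorem z_mul_X_pow (i : ZMod 3) : D.z i * D.X ^ (c - 1) = D.X ^ (c - 1) := by
  rw [D.mul_X_pow (D.z i) (n := 1) (by simp [D.p₀_z])]
  simp

theorem p₁_intCast (n : ℤ) : D.p₁ n = 0 := by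
  have h : D.p₁ (n • (1 : R)) = n • D.p₁ 1 := map_zsmul _ _ _
  simpa [D.p₁_one] using h

theorem p₁_natCast (n : ℕ) : D.p₁ n = 0 := by
  simpa using D.p₁_intCast n

theorem p₁_ofNat (n : ℕ) [n.AtLeastTwo] : D.p₁ (OfNat.ofNat n) = 0 := D.p₁_natCast n

omit D in
/-- The carry of the addition of two residues modulo `3`. -/
def carry (i j : ZMod 3) : ℤ := if 3 ≤ i.val + j.val then 1 else 0

omit D in
theorem carry_add (i j k : ZMod 3) :
    carry i j + carry (i + j) k = carry j k + carry i (j + k) := by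
  revert i j k
  decide

omit D in
theorem carry_zero_left (i : ZMod 3) : carry 0 i = 0 := by
  revert i
  decide

end Uniserial

open Uniserial

/-! ### The model of the groups `G_c(α, β)` -/

/-- The group with normal subgroup `R × 𝔽₃`, where `R × 𝔽₃` has the Heisenberg multiplication
`(u, t) (v, s) = (u + v, t + s + ω(u, v) / 2)`, and with quotient of order `3` generated by
`x = (1, 0, 0)`, which acts on `R` as multiplication by `1 + X` and whose cube is
`α X ^ (c - 1)`. The triple `(i, u, t)` stands for `x ^ i (u, t)`; note `1 / 2 = -1` in `𝔽₃`. -/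
@[ext] structure Model {c β : ℕ} {R : Type*} [CommRing R] (D : Uniserial c β R) (α : ℕ) where
  i : ZMod 3
  u : R
  t : ZMod 3

namespace Model

variable {c β : ℕ} {R : Type*} [CommRing R] {D : Uniserial c β R} {α : ℕ}

instance : Mul (Model D α) where
  mul a b := ⟨a.i + b.i, D.z b.i * a.u + b.u + α * carry a.i b.i * D.X ^ (c - 1),
    a.t + b.t - D.ω (D.z b.i * a.u) b.u⟩

instance : One (Model D α) where
  one := ⟨0, 0, 0⟩

instance : Inv (Model D α) where
  inv a := ⟨-a.i, - (D.z (-a.i) * a.u) - α * carry (-a.i) a.i * D.X ^ (c - 1), -a.t⟩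

@[simp] theorem one_i : (1 : Model D α).i = 0 := rfl
@[simp] theorem one_u : (1 : Model D α).u = 0 := rfl
@[simp] theorem one_t : (1 : Model D α).t = 0 := rfl
@[simp] theorem mul_i (a b : Model D α) : (a * b).i = a.i + b.i := rfl
theorem mul_u (a b : Model D α) :
    (a * b).u = D.z b.i * a.u + b.u + α * carry a.i b.i * D.X ^ (c - 1) := rfl
theorem mul_t' (a b : Model D α) : (a * b).t = a.t + b.t - D.ω (D.z b.i * a.u) b.u := rfl
theorem inv_i' (a : Model D α) : a⁻¹.i = -a.i := rfl
theorem inv_u' (a : Model D α) :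
    a⁻¹.u = - (D.z (-a.i) * a.u) - α * carry (-a.i) a.i * D.X ^ (c - 1) := rfl
theorem inv_t' (a : Model D α) : a⁻¹.t = - a.t := rfl

/-- The `t`-coordinate of a product, in terms of the coefficients `p₀` and `p₁`. -/
theorem mul_t (a b : Model D α) : (a * b).t = a.t + b.t -
    ((b.i * D.p₀ a.u + D.p₁ a.u) * D.p₀ b.u - D.p₀ a.u * D.p₁ b.u) := by
  rw [mul_t', ω, D.p₁_mul, map_mul, D.p₀_z, D.p₁_z]
  ring

@[simp] theorem mul_p₀ (a b : Model D α) : D.p₀ (a * b).u = D.p₀ a.u + D.p₀ b.u := by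
  rw [mul_u, map_add, map_add, map_mul, D.p₀_z, map_mul, D.p₀_X_pow_pred]
  ring

theorem mul_p₁ (a b : Model D α) :
    D.p₁ (a * b).u = b.i * D.p₀ a.u + D.p₁ a.u + D.p₁ b.u := by
  rw [mul_u, map_add, map_add, D.p₁_mul, D.p₀_z, D.p₁_z, D.p₁_mul, D.p₁_X_pow_pred,
    D.p₀_X_pow_pred]
  ring

theorem mul_assoc' (a b d : Model D α) : a * b * d = a * (b * d) := by
  ext
  · simp [add_assoc]
  · have h := congrArg (Int.cast : ℤ → R) (carry_add a.i b.i d.i)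
    push_cast at h
    simp only [mul_u, mul_i, D.z_add]
    linear_combination (α : R) * D.X ^ (c - 1) * h
      + α * carry a.i b.i * D.z_mul_X_pow d.i
  · simp only [mul_t, mul_i, mul_p₀, mul_p₁]
    ring

theorem inv_mul_cancel' (a : Model D α) : a⁻¹ * a = 1 := by
  have hz : D.z a.i * D.z (-a.i) = 1 := by
    rw [← D.z_add, add_neg_cancel, D.z_zero]
  ext
  · simp [inv_i']
  · simp only [mul_u, inv_u', inv_i', one_u]
    linear_combination (-a.u) * hz - α * carry (-a.i) a.i * D.z_mul_X_pow a.i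
  · simp only [mul_t, inv_t', inv_u', one_t, map_sub, map_neg, D.p₁_mul, map_mul, D.p₀_z, D.p₁_z,
      D.p₀_X_pow_pred, D.p₁_X_pow_pred]
    ring

instance : Group (Model D α) :=
  Group.ofLeftAxioms mul_assoc'
    (fun a => by ext <;> simp [mul_u, mul_t, carry_zero_left]) inv_mul_cancel'

end Model

/-! ### Systems of generators satisfying the parametrized relations -/

theorem comm_eq_iff {G : Type*} [Group G] {g h k : G} : comm g h = k ↔ g * h = h * g * k := by
  rw [comm, mul_assoc, mul_assoc, inv_mul_eq_iff_eq_mul, inv_mul_eq_iff_eq_mul, mul_assoc]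

theorem comm_eq_one_iff {G : Type*} [Group G] {g h : G} : comm g h = 1 ↔ Commute g h := by
  rw [comm_eq_iff, mul_one, commute_iff_eq]

theorem map_comm {G H : Type*} [Group G] [Group H] (f : G →* H) (g h : G) :
    f (comm g h) = comm (f g) (f h) := by simp [comm]

/-- Elements of a group which satisfy the relations of `G_c(α, β)`. Putting `s_j = 1` for `j > c`
makes the relations uniform in `j`. -/
structure PcSystem (c α β : ℕ) (G : Type*) [Group G] where
  x : G
  y : G
  t : G
  s : ℕ → G
  s_eq_one (j : ℕ) (hj : c < j) : s j = 1
  comm_y_x : comm y x = s 2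
  comm_s₂_y : comm (s 2) y = t
  comm_s_x (j : ℕ) (hj : 2 ≤ j) : comm (s j) x = s (j + 1)
  comm_s_y (j : ℕ) (hj : 3 ≤ j) : Commute (s j) y
  comm_t_x : Commute t x
  comm_t_y : Commute t y
  comm_s_s (i j : ℕ) (hi : 2 ≤ i) (hj : 2 ≤ j) : Commute (s i) (s j)
  comm_s_t (j : ℕ) (hj : 2 ≤ j) : Commute (s j) t
  pow_s (j : ℕ) (hj : 2 ≤ j) : s j ^ 3 = s (j + 2) ^ 2 * s (j + 3)
  pow_t : t ^ 3 = 1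
  pow_x : x ^ 3 = s c ^ α
  pow_y : y ^ 3 = s c ^ β * s 4 * s 3 ^ 2

theorem comm_mem {G : Type*} [Group G] {K : Subgroup G} {g h : G} (hg : g ∈ K) (hh : h ∈ K) :
    comm g h ∈ K :=
  K.mul_mem (K.mul_mem (K.mul_mem (K.inv_mem hg) (K.inv_mem hh)) hg) hh

namespace PcSystem

variable {c α β : ℕ} {G H : Type*} [Group G] [Group H]

theorem s_mem (P : PcSystem c α β G) {K : Subgroup G} (hx : P.x ∈ K) (hy : P.y ∈ K) {j : ℕ}
    (hj : 2 ≤ j) : P.s j ∈ K := by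
  induction j, hj using Nat.le_induction with
  | base => rw [← P.comm_y_x]; exact comm_mem hy hx
  | succ n hn ih => rw [← P.comm_s_x n hn]; exact comm_mem ih hx

theorem t_mem (P : PcSystem c α β G) {K : Subgroup G} (hx : P.x ∈ K) (hy : P.y ∈ K) :
    P.t ∈ K := by
  rw [← P.comm_s₂_y]
  exact comm_mem (P.s_mem hx hy le_rfl) hy

/-- The image of a system under a homomorphism. -/
def map (P : PcSystem c α β G) (f : G →* H) : PcSystem c α β H where
  x := f P.x
  y := f P.y
  t := f P.t
  s j := f (P.s j)
  s_eq_one j hj := by rw [P.s_eq_one j hj, map_one]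
  comm_y_x := by rw [← map_comm, P.comm_y_x]
  comm_s₂_y := by rw [← map_comm, P.comm_s₂_y]
  comm_s_x j hj := by rw [← map_comm, P.comm_s_x j hj]
  comm_s_y j hj := (P.comm_s_y j hj).map f
  comm_t_x := P.comm_t_x.map f
  comm_t_y := P.comm_t_y.map f
  comm_s_s i j hi hj := (P.comm_s_s i j hi hj).map f
  comm_s_t j hj := (P.comm_s_t j hj).map f
  pow_s j hj := by rw [← map_pow, P.pow_s j hj, map_mul, map_pow]
  pow_t := by rw [← map_pow, P.pow_t, map_one]
  pow_x := by rw [← map_pow, P.pow_x, map_pow]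
  pow_y := by rw [← map_pow, P.pow_y, map_mul, map_mul, map_pow, map_pow]

/-- The elements of a system, as images of the generators of the presentation. -/
def gen (P : PcSystem c α β G) : Gen c → G
  | .x => P.x
  | .y => P.y
  | .t₃ => P.t
  | .s j _ _ => P.s j

theorem lift_gen_ws (P : PcSystem c α β G) {j : ℕ} (hj : 2 ≤ j) :
    FreeGroup.lift P.gen (ws c j) = P.s j := by
  rw [ws]
  split_ifs with h
  · simp [gen]
  · rw [map_one, P.s_eq_one j (by omega)]

theorem lift_gen_wx (P : PcSystem c α β G) : FreeGroup.lift P.gen (wx c) = P.x := by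
  simp [wx, gen]

theorem lift_gen_wy (P : PcSystem c α β G) : FreeGroup.lift P.gen (wy c) = P.y := by
  simp [wy, gen]

theorem lift_gen_wt (P : PcSystem c α β G) : FreeGroup.lift P.gen (wt c) = P.t := by
  simp [wt, gen]

theorem lift_gen_eq {α : Fin 2} {β : Fin 3} (hc : 5 ≤ c) (P : PcSystem c α β G)
    {l r : FreeGroup (Gen c)} (h : PcEq c α β l r) :
    FreeGroup.lift P.gen l = FreeGroup.lift P.gen r := by
  have hs {j : ℕ} (hj : 2 ≤ j) := P.lift_gen_ws hj
  have hx := P.lift_gen_wx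
  have hy := P.lift_gen_wy
  have ht := P.lift_gen_wt
  cases h with
  | def_s₂ => rw [map_comm, hs le_rfl, hx, hy, P.comm_y_x]
  | def_t₃ => rw [map_comm, hs le_rfl, hy, ht, P.comm_s₂_y]
  | def_s j h₁ h₂ =>
    rw [map_comm, hs (by omega), hs (by omega), hx, P.comm_s_x _ (by omega),
      Nat.sub_add_cancel (by omega)]
  | pow_s j h₁ h₂ =>
    rw [map_pow, map_mul, map_pow, hs h₁, hs (by omega), hs (by omega), P.pow_s j h₁]
  | pow_s_antepenult =>
    rw [map_pow, map_pow, hs (by omega), hs (by omega), P.pow_s _ (by omega),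
      P.s_eq_one (c - 2 + 3) (by omega), mul_one, Nat.sub_add_cancel (by omega)]
  | pow_t₃ => rw [map_pow, map_one, ht, P.pow_t]
  | rel_x => rw [map_pow, map_pow, hx, hs (by omega), P.pow_x]
  | rel_y =>
    rw [map_pow, map_mul, map_mul, map_pow, map_pow, hy, hs (by omega), hs (by omega),
      hs (by omega), P.pow_y]
  | pow_s_penult =>
    rw [map_pow, map_one, hs (by omega), P.pow_s _ (by omega), P.s_eq_one _ (by omega),
      P.s_eq_one _ (by omega), one_pow, one_mul]
  | pow_s_last =>
    rw [map_pow, map_one, hs (by omega), P.pow_s _ (by omega), P.s_eq_one _ (by omega),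
      P.s_eq_one _ (by omega), one_pow, one_mul]
  | comm_s_last_x =>
    rw [map_comm, map_one, hs (by omega), hx, P.comm_s_x _ (by omega), P.s_eq_one _ (by omega)]
  | comm_s_y j h₁ h₂ =>
    rw [map_comm, map_one, hs (by omega), hy, comm_eq_one_iff]
    exact P.comm_s_y j h₁
  | comm_t₃_x =>
    rw [map_comm, map_one, ht, hx, comm_eq_one_iff]
    exact P.comm_t_x
  | comm_t₃_y =>
    rw [map_comm, map_one, ht, hy, comm_eq_one_iff]
    exact P.comm_t_y
  | comm_s_s i j hi₁ hi₂ hj₁ hj₂ =>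
    rw [map_comm, map_one, hs hi₁, hs hj₁, comm_eq_one_iff]
    exact P.comm_s_s i j hi₁ hj₁
  | comm_s_t₃ j h₁ h₂ =>
    rw [map_comm, map_one, hs h₁, ht, comm_eq_one_iff]
    exact P.comm_s_t j h₁

/-- The homomorphism from `G_c(α, β)` given by a system in `G`. -/
def lift {α : Fin 2} {β : Fin 3} (hc : 5 ≤ c) (P : PcSystem c α β G) : QGroup c α β →* G :=
  PresentedGroup.toGroup (f := P.gen) (by
    rintro _ ⟨l, r, h, rfl⟩
    rw [map_mul, map_inv, P.lift_gen_eq hc h, mul_inv_cancel])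

end PcSystem

section presented

variable {c : ℕ} {α : Fin 2} {β : Fin 3}

theorem mk_eq_mk {l r : FreeGroup (Gen c)} (h : PcEq c α β l r) :
    QGroup.mk α β l = QGroup.mk α β r := by
  have h' : QGroup.mk α β (l * r⁻¹) = 1 := PresentedGroup.one_of_mem ⟨l, r, h, rfl⟩
  rwa [QGroup.mk, map_mul, map_inv, mul_inv_eq_one] at h'

variable (α β)

theorem mk_ws_of_lt {j : ℕ} (hj : c < j) : QGroup.mk α β (ws c j) = 1 := by
  rw [ws, dif_neg (by omega), QGroup.mk, map_one]

/-- The generators of `G_c(α, β)` form a system. -/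
def QGroup.sys (hc : 5 ≤ c) : PcSystem c α β (QGroup c α β) where
  x := QGroup.mk α β (wx c)
  y := QGroup.mk α β (wy c)
  t := QGroup.mk α β (wt c)
  s j := QGroup.mk α β (ws c j)
  s_eq_one j hj := mk_ws_of_lt α β hj
  comm_y_x := by rw [mk_eq_mk .def_s₂]; exact (map_comm _ _ _).symm
  comm_s₂_y := by rw [mk_eq_mk .def_t₃]; exact (map_comm _ _ _).symm
  comm_s_x j hj := by
    rcases lt_trichotomy j c with h | rfl | h
    · rw [mk_eq_mk (.def_s (j + 1) (by omega) h)]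
      exact (map_comm _ _ _).symm
    · rw [mk_ws_of_lt α β (Nat.lt_succ_self j)]
      exact (map_comm _ _ _).symm.trans ((mk_eq_mk .comm_s_last_x).trans (map_one _))
    · rw [mk_ws_of_lt α β h, mk_ws_of_lt α β (by omega)]
      simp [comm]
  comm_s_y j hj := by
    by_cases h : j ≤ c
    · rw [← comm_eq_one_iff]
      exact (map_comm _ _ _).symm.trans ((mk_eq_mk (.comm_s_y j hj h)).trans (map_one _))
    · rw [mk_ws_of_lt α β (by omega)]
      exact Commute.one_left _
  comm_t_x := by
    rw [← comm_eq_one_iff]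
    exact (map_comm _ _ _).symm.trans ((mk_eq_mk .comm_t₃_x).trans (map_one _))
  comm_t_y := by
    rw [← comm_eq_one_iff]
    exact (map_comm _ _ _).symm.trans ((mk_eq_mk .comm_t₃_y).trans (map_one _))
  comm_s_s i j hi hj := by
    by_cases h : i ≤ c
    · by_cases h' : j ≤ c
      · rw [← comm_eq_one_iff]
        exact (map_comm _ _ _).symm.trans
          ((mk_eq_mk (.comm_s_s i j hi h hj h')).trans (map_one _))
      · rw [mk_ws_of_lt α β (j := j) (by omega)]
        exact Commute.one_right _
    · rw [mk_ws_of_lt α β (j := i) (by omega)]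
      exact Commute.one_left _
  comm_s_t j hj := by
    by_cases h : j ≤ c
    · rw [← comm_eq_one_iff]
      exact (map_comm _ _ _).symm.trans ((mk_eq_mk (.comm_s_t₃ j hj h)).trans (map_one _))
    · rw [mk_ws_of_lt α β (by omega)]
      exact Commute.one_left _
  pow_s j hj := by
    rcases lt_or_ge c j with h | h
    · rw [mk_ws_of_lt α β h, mk_ws_of_lt α β (by omega), mk_ws_of_lt α β (by omega)]
      simp
    · obtain h | rfl | rfl | rfl : j + 3 ≤ c ∨ c = j + 2 ∨ c = j + 1 ∨ c = j := by omega
      · exact mk_eq_mk (.pow_s j hj h)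
      · rw [mk_ws_of_lt α β (j := j + 3) (by omega), mul_one]
        exact mk_eq_mk (c := j + 2) .pow_s_antepenult
      · rw [mk_ws_of_lt α β (j := j + 3) (by omega), mk_ws_of_lt α β (j := j + 2) (by omega),
          one_pow, mul_one]
        exact mk_eq_mk (c := j + 1) .pow_s_penult
      · rw [mk_ws_of_lt α β (j := c + 3) (by omega), mk_ws_of_lt α β (j := c + 2) (by omega),
          one_pow, mul_one]
        exact mk_eq_mk .pow_s_last
  pow_t := mk_eq_mk .pow_t₃
  pow_x := mk_eq_mk .rel_x
  pow_y := mk_eq_mk .rel_y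

theorem QGroup.closure_eq_top (hc : 5 ≤ c) :
    Subgroup.closure {(QGroup.sys α β hc).x, (QGroup.sys α β hc).y} = ⊤ := by
  let P := QGroup.sys α β hc
  set K := Subgroup.closure {P.x, P.y} with hK
  have hx : P.x ∈ K := Subgroup.subset_closure (by simp)
  have hy : P.y ∈ K := Subgroup.subset_closure (by simp)
  rw [eq_top_iff, ← PresentedGroup.closure_range_of, Subgroup.closure_le]
  rintro _ ⟨g, rfl⟩
  cases g with
  | x => exact hx
  | y => exact hy
  | t₃ => exact P.t_mem hx hy
  | s j h₁ h₂ =>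
    have h := P.s_mem hx hy h₁
    simp only [P, QGroup.sys, ws, h₁, h₂, and_self, dif_pos] at h
    exact h

end presented

/-! ### Order and class of a group generated by a system -/

section general

open scoped Pointwise commutatorElement

variable {G : Type*} [Group G]

theorem finite_sup_zpowers (H : Subgroup G) [Finite H] {S : Set G} (hS : H = Subgroup.closure S)
    (g : G) (hg : ∀ h ∈ S, comm h g ∈ H) (hg3 : g ^ 3 ∈ H) :
    Finite (H ⊔ Subgroup.zpowers g : Subgroup G) ∧
      Nat.card (H ⊔ Subgroup.zpowers g : Subgroup G) ≤ 3 * Nat.card H := by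
  have hconj (h : G) (hh : h ∈ H) : g⁻¹ * h * g ∈ H := by
    have hle : H ≤ H.comap (MulAut.conj g⁻¹).toMonoidHom := by
      conv_lhs => rw [hS]
      rw [Subgroup.closure_le]
      intro s hs
      have h1 : g⁻¹ * s * g = s * comm s g := by simp [comm, mul_assoc]
      have hsH : s ∈ H := hS ▸ Subgroup.subset_closure hs
      simpa [h1] using H.mul_mem hsH (hg s hs)
    simpa using hle hh
  have hn : g⁻¹ ∈ Subgroup.normalizer (H : Set G) := by
    have : Finite (H : Set G) := ‹Finite H›
    exact Subgroup.mem_normalizer_fintype fun n hn => by simpa using hconj n hn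
  have hz : Subgroup.zpowers g ≤ Subgroup.normalizer (H : Set G) := by
    rw [Subgroup.zpowers_le]
    simpa using inv_mem hn
  have hmul := Subgroup.coe_mul_of_left_le_normalizer_right (Subgroup.zpowers g) H hz
  rw [sup_comm]
  let f : Fin 3 × H → (Subgroup.zpowers g ⊔ H : Subgroup G) := fun p =>
    ⟨g ^ (p.1 : ℕ) * p.2, Subgroup.mul_mem_sup
      (Subgroup.npow_mem_zpowers g p.1) p.2.2⟩
  have hf : Function.Surjective f := by
    rintro ⟨a, ha⟩
    have ha' : a ∈ (Subgroup.zpowers g : Set G) * (H : Set G) := by rw [← hmul]; exact ha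
    obtain ⟨_, ⟨k, rfl⟩, h, hh, rfl⟩ := ha'
    refine ⟨(⟨(k % 3).toNat, by omega⟩, ⟨(g ^ 3) ^ (k / 3) * h, H.mul_mem (H.zpow_mem hg3 _) hh⟩),
      Subtype.ext ?_⟩
    have hk : g ^ k = g ^ (k % 3).toNat * (g ^ 3) ^ (k / 3) := by
      rw [← zpow_natCast, ← zpow_natCast, ← zpow_mul, ← zpow_add, Int.toNat_of_nonneg (by omega)]
      congr 1
      push_cast
      omega
    simp only [f]
    rw [← mul_assoc, ← hk]
  refine ⟨Finite.of_surjective f hf, (Nat.card_le_card_of_surjective f hf).trans ?_⟩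
  rw [Nat.card_prod, Nat.card_fin]

theorem commutator_mem_of_closure {N : Subgroup G} [N.Normal] {S : Set G}
    (hS : Subgroup.closure S = ⊤) {a : G} (h : ∀ s ∈ S, comm a s ∈ N) (g : G) : ⁅a, g⁆ ∈ N := by
  have hle : Subgroup.closure S ≤
      (Subgroup.centralizer {QuotientGroup.mk' N a}).comap (QuotientGroup.mk' N) := by
    rw [Subgroup.closure_le]
    intro s hs
    have h1 : comm (QuotientGroup.mk' N a) (QuotientGroup.mk' N s) = 1 := by
      rw [← map_comm]
      exact (QuotientGroup.eq_one_iff _).2 (h s hs)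
    rw [comm_eq_one_iff] at h1
    simpa [Subgroup.mem_centralizer_iff] using h1.eq
  have hg : g ∈ Subgroup.closure S := hS ▸ Subgroup.mem_top g
  have h2 := hle hg
  rw [Subgroup.mem_comap, Subgroup.mem_centralizer_iff] at h2
  rw [← QuotientGroup.eq_one_iff]
  change ⁅QuotientGroup.mk' N a, QuotientGroup.mk' N g⁆ = 1
  rw [commutatorElement_eq_one_iff_mul_comm]
  exact h2 _ rfl

theorem comm_mem_commutator {H K : Subgroup G} {g h : G} (hg : g ∈ H) (hh : h ∈ K) :
    comm g h ∈ ⁅H, K⁆ := by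
  have : comm g h = ⁅g⁻¹, h⁻¹⁆ := by simp [comm, commutatorElement_def]
  rw [this]
  exact Subgroup.commutator_mem_commutator (H.inv_mem hg) (K.inv_mem hh)

end general

namespace PcSystem

variable {c α β : ℕ} {G : Type*} [Group G] (P : PcSystem c α β G)

include P

/-- The subgroup generated by the last `n` of the generators `s_j`. -/
def tail (n : ℕ) : Subgroup G := Subgroup.closure {g | ∃ j, 2 ≤ j ∧ c < j + n ∧ g = P.s j}

theorem s_mem_tail {n j : ℕ} (hj : 2 ≤ j) (hn : c < j + n) : P.s j ∈ P.tail n :=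
  Subgroup.subset_closure ⟨j, hj, hn, rfl⟩

theorem card_tail_le {n : ℕ} (hn : n + 1 ≤ c) : Finite (P.tail n) ∧ Nat.card (P.tail n) ≤ 3 ^ n := by
  induction n with
  | zero =>
    have h : P.tail 0 = ⊥ := by
      rw [tail, Subgroup.closure_eq_bot_iff]
      rintro _ ⟨j, -, hj, rfl⟩
      exact P.s_eq_one j (by omega)
    rw [h]
    exact ⟨inferInstance, by simp⟩
  | succ n ih =>
    obtain ⟨hf, hcard⟩ := ih (by omega)
    have h : P.tail (n + 1) = P.tail n ⊔ Subgroup.zpowers (P.s (c - n)) := by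
      refine le_antisymm ?_ (sup_le (Subgroup.closure_mono ?_) ?_)
      · rw [tail, Subgroup.closure_le]
        rintro _ ⟨j, hj, hj', rfl⟩
        by_cases h : c < j + n
        · exact Subgroup.mem_sup_left (P.s_mem_tail hj h)
        · rw [show j = c - n by omega]
          exact Subgroup.mem_sup_right (Subgroup.mem_zpowers _)
      · rintro _ ⟨j, hj, hj', rfl⟩
        exact ⟨j, hj, by omega, rfl⟩
      · rw [Subgroup.zpowers_le]
        exact P.s_mem_tail (by omega) (by omega)
    rw [h]
    have key := finite_sup_zpowers (P.tail n) rfl (P.s (c - n)) (by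
      rintro _ ⟨j, hj, -, rfl⟩
      rw [comm_eq_one_iff.2 (P.comm_s_s j _ hj (by omega))]
      exact one_mem _) (by
      rw [P.pow_s _ (by omega)]
      exact mul_mem (pow_mem (P.s_mem_tail (by omega) (by omega)) 2)
        (P.s_mem_tail (by omega) (by omega)))
    refine ⟨key.1, key.2.trans ?_⟩
    rw [pow_succ']
    omega

/-- A group generated by a system has at most the expected order. -/
theorem card_le (hc : 3 ≤ c) (htop : Subgroup.closure {P.x, P.y} = ⊤) :
    Finite G ∧ Nat.card G ≤ 3 ^ (c + 2) := by
  obtain ⟨hf₀, h₀⟩ := P.card_tail_le (n := c - 1) (by omega)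
  set A := P.tail (c - 1) with hA
  have hs {j : ℕ} (hj : 2 ≤ j) : P.s j ∈ A := P.s_mem_tail hj (by omega)
  obtain ⟨hf₁, h₁⟩ := finite_sup_zpowers A rfl P.t (by
    rintro _ ⟨j, hj, -, rfl⟩
    rw [comm_eq_one_iff.2 (P.comm_s_t j hj)]
    exact one_mem _) (by rw [P.pow_t]; exact one_mem _)
  set B := A ⊔ Subgroup.zpowers P.t with hB
  have hsB {j : ℕ} (hj : 2 ≤ j) : P.s j ∈ B := Subgroup.mem_sup_left (hs hj)
  have htB : P.t ∈ B := Subgroup.mem_sup_right (Subgroup.mem_zpowers _)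
  have hBcl : B = Subgroup.closure ({g | ∃ j, 2 ≤ j ∧ g = P.s j} ∪ {P.t}) := by
    rw [Subgroup.closure_union, hB, hA, tail, Subgroup.zpowers_eq_closure]
    congr 2
    ext g
    exact exists_congr fun j => and_congr_right fun hj => and_iff_right (by omega)
  obtain ⟨hf₂, h₂⟩ := finite_sup_zpowers B hBcl P.y (by
    rintro _ (⟨j, hj, rfl⟩ | rfl)
    · obtain rfl | hj' : j = 2 ∨ 3 ≤ j := by omega
      · rwa [P.comm_s₂_y]
      · rw [comm_eq_one_iff.2 (P.comm_s_y j hj')]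
        exact one_mem _
    · rw [comm_eq_one_iff.2 P.comm_t_y]
      exact one_mem _) (by
    rw [P.pow_y]
    exact mul_mem (mul_mem (pow_mem (hsB (by omega)) _) (hsB (by omega)))
      (pow_mem (hsB (by omega)) _))
  set N := B ⊔ Subgroup.zpowers P.y with hN
  have hNcl : N = Subgroup.closure ({g | ∃ j, 2 ≤ j ∧ g = P.s j} ∪ {P.t} ∪ {P.y}) := by
    rw [Subgroup.closure_union, ← hBcl, hN, Subgroup.zpowers_eq_closure]
  have hBN : B ≤ N := le_sup_left
  obtain ⟨hf₃, h₃⟩ := finite_sup_zpowers N hNcl P.x (by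
    rintro _ ((⟨j, hj, rfl⟩ | rfl) | rfl)
    · rw [P.comm_s_x j hj]
      exact hBN (hsB (by omega))
    · rw [comm_eq_one_iff.2 P.comm_t_x]
      exact one_mem _
    · rw [P.comm_y_x]
      exact hBN (hsB le_rfl)) (by
    rw [P.pow_x]
    exact hBN (pow_mem (hsB (by omega)) _))
  have hG : N ⊔ Subgroup.zpowers P.x = ⊤ := by
    rw [eq_top_iff, ← htop, Subgroup.closure_le]
    rintro _ (rfl | rfl)
    · exact Subgroup.mem_sup_right (Subgroup.mem_zpowers _)
    · exact Subgroup.mem_sup_left (Subgroup.mem_sup_right (Subgroup.mem_zpowers _))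
  rw [hG] at hf₃ h₃
  refine ⟨(Nat.finite_of_card_ne_zero ?_ : Finite G), ?_⟩
  · rw [← Subgroup.card_top]
    exact Nat.card_pos.ne'
  · rw [Subgroup.card_top] at h₃
    rw [show c + 2 = (c - 1) + 3 by omega, pow_add]
    omega

theorem mem_upperCentralSeries (hc : 3 ≤ c) (htop : Subgroup.closure {P.x, P.y} = ⊤) (k : ℕ) :
    (1 ≤ k → P.t ∈ Subgroup.upperCentralSeries G k) ∧
      ∀ j, 2 ≤ j → c < j + k → P.s j ∈ Subgroup.upperCentralSeries G k := by
  induction k with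
  | zero =>
    refine ⟨by omega, fun j _ hj' => ?_⟩
    rw [P.s_eq_one j (by omega)]
    exact one_mem _
  | succ k ih =>
    refine ⟨fun _ => ?_, fun j hj hj' => ?_⟩
    · refine commutator_mem_of_closure (N := Subgroup.upperCentralSeries G _) htop ?_
      rintro _ (rfl | rfl)
      · rw [comm_eq_one_iff.2 P.comm_t_x]
        exact one_mem _
      · rw [comm_eq_one_iff.2 P.comm_t_y]
        exact one_mem _
    · refine commutator_mem_of_closure (N := Subgroup.upperCentralSeries G _) htop ?_
      rintro _ (rfl | rfl)
      · rw [P.comm_s_x j hj]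
        exact ih.2 _ (by omega) (by omega)
      · obtain rfl | hj' : j = 2 ∨ 3 ≤ j := by omega
        · rw [P.comm_s₂_y]
          exact ih.1 (by omega)
        · rw [comm_eq_one_iff.2 (P.comm_s_y j hj')]
          exact one_mem _

/-- A group generated by a system of parameter `c` has class at most `c`. -/
theorem lowerCentralSeries_eq_bot (hc : 3 ≤ c) (htop : Subgroup.closure {P.x, P.y} = ⊤) :
    (⊤ : Subgroup G).lowerCentralSeries c = ⊥ := by
  rw [Subgroup.lowerCentralSeries_eq_bot_iff_upperCentralSeries_eq_top, eq_top_iff, ← htop,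
    Subgroup.closure_le]
  have h := (P.mem_upperCentralSeries hc htop (c - 1)).2 2 le_rfl (by omega)
  obtain ⟨k, rfl⟩ : ∃ k, c = k + 1 := ⟨c - 1, by omega⟩
  have hinv : comm P.x P.y = (P.s 2)⁻¹ := by
    rw [← P.comm_y_x]
    simp [comm, mul_assoc]
  rintro _ (rfl | rfl) <;> refine commutator_mem_of_closure (N := Subgroup.upperCentralSeries G _) htop ?_ <;> rintro _ (rfl | rfl)
  · rw [comm_eq_one_iff.2 (Commute.refl _)]
    exact one_mem _
  · rw [hinv]
    exact inv_mem h
  · rw [P.comm_y_x]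
    exact h
  · rw [comm_eq_one_iff.2 (Commute.refl _)]
    exact one_mem _

theorem s_mem_lowerCentralSeries {j : ℕ} (hj : 2 ≤ j) :
    P.s j ∈ (⊤ : Subgroup G).lowerCentralSeries (j - 1) := by
  induction j, hj using Nat.le_induction with
  | base =>
    rw [← P.comm_y_x]
    exact comm_mem_commutator (Subgroup.mem_top _) (Subgroup.mem_top _)
  | succ n hn ih =>
    have h := comm_mem_commutator ih (Subgroup.mem_top P.x)
    rw [P.comm_s_x n hn] at h
    obtain ⟨k, rfl⟩ : ∃ k, n = k + 1 := ⟨n - 1, by omega⟩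
    exact h

theorem s_mem_commutator {j : ℕ} (hj : 2 ≤ j) : P.s j ∈ commutator G :=
  Subgroup.lowerCentralSeries_antitone (⊤ : Subgroup G) (by omega : 1 ≤ j - 1)
    (P.s_mem_lowerCentralSeries hj)

theorem t_mem_commutator : P.t ∈ commutator G := by
  rw [← P.comm_s₂_y]
  exact comm_mem_commutator (Subgroup.mem_top _) (Subgroup.mem_top _)

omit P

/-- A system of smaller parameter `c` with `α = β = 0` is one of parameter `c'` with arbitrary
`α` and `β`, since the additional generators are trivial. -/
def extend (P : PcSystem c 0 0 G) {c' : ℕ} (h : c < c') (α β : ℕ) :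
    PcSystem c' α β G where
  __ := P
  s_eq_one j hj := P.s_eq_one j (by omega)
  pow_x := by rw [P.pow_x, P.s_eq_one c' h, one_pow, pow_zero]
  pow_y := by rw [P.pow_y, P.s_eq_one c' h, one_pow, pow_zero]

/-- If the generators `s_j` with `j > c` are trivial, the parameter can be lowered to `c`. -/
def truncate {c' : ℕ} (P : PcSystem c' α β G) (h : c < c') (hs : ∀ j, c < j → P.s j = 1) :
    PcSystem c 0 0 G where
  __ := P
  s_eq_one := hs
  pow_x := by rw [P.pow_x, hs c' h, one_pow, pow_zero]
  pow_y := by rw [P.pow_y, hs c' h, one_pow, pow_zero]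

end PcSystem

/-! ### Systems in the model, and the order of the presented groups -/

namespace Uniserial

variable {c β : ℕ} {R : Type*} [CommRing R] (D : Uniserial c β R)

include D

theorem mul_X_pow_inj {u v : R} :
    u * D.X ^ (c - 1) = v * D.X ^ (c - 1) ↔ D.p₀ u = D.p₀ v := by
  obtain ⟨n, hn⟩ := ZMod.intCast_surjective (D.p₀ (u - v))
  have h := D.mul_X_pow (u - v) hn
  have h' := D.int_mul_X_pow n
  rw [← h, hn] at h'
  rw [← sub_eq_zero, ← sub_mul, h', map_sub, sub_eq_zero]

theorem z_sum {a : ZMod 3} (ha : a ≠ 0) : D.z a ^ 2 + D.z a + 1 = β * D.X ^ (c - 1) := by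
  obtain rfl | rfl | rfl : a = 0 ∨ a = 1 ∨ a = 2 := by revert a; decide
  · exact absurd rfl ha
  · rw [D.z_one]
    linear_combination D.quad
  · rw [D.z_two]
    linear_combination D.quad + (1 + D.X) * D.X_add_one_pow

theorem exists_z_sub_one' (a : ZMod 3) :
    ∃ q, D.z a - 1 = D.X * q ∧ D.p₀ q = a ∧ D.p₁ q = a - a ^ 2 := by
  obtain rfl | rfl | rfl : a = 0 ∨ a = 1 ∨ a = 2 := by revert a; decide
  · exact ⟨0, by simp [D.z_zero], by simp, by simp⟩
  · exact ⟨1, by simp [D.z_one], by simp, by simp [D.p₁_one]⟩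
  · refine ⟨2 + D.X, by rw [D.z_two]; ring, ?_, ?_⟩
    · rw [map_add, D.p₀_X, map_ofNat, add_zero]
    · rw [map_add, D.p₁_X, D.p₁_ofNat]
      decide

theorem exists_z_sub_one (a : ZMod 3) : ∃ q, D.z a - 1 = D.X * q ∧ D.p₀ q = a :=
  (D.exists_z_sub_one' a).imp fun _ h => ⟨h.1, h.2.1⟩

theorem z_sub_one_pow_eq_zero (a : ZMod 3) {n : ℕ} (hn : c ≤ n) : (D.z a - 1) ^ n = 0 := by
  obtain ⟨q, hq, -⟩ := D.exists_z_sub_one a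
  rw [hq, mul_pow, ← Nat.sub_add_cancel hn, pow_add D.X, D.X_pow]
  ring

theorem p₀_z_sub_one (a : ZMod 3) : D.p₀ (D.z a - 1) = 0 := by
  rw [map_sub, D.p₀_z, map_one, sub_self]

theorem p₀_z_sub_one_pow_mul (a : ZMod 3) {n : ℕ} (hn : n ≠ 0) (v : R) :
    D.p₀ ((D.z a - 1) ^ n * v) = 0 := by
  rw [map_mul, map_pow, D.p₀_z_sub_one, zero_pow hn, zero_mul]

theorem p₁_z_sub_one_pow_mul (a : ZMod 3) {n : ℕ} (hn : 2 ≤ n) (v : R) :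
    D.p₁ ((D.z a - 1) ^ n * v) = 0 := by
  obtain ⟨k, rfl⟩ := Nat.exists_eq_add_of_le' hn
  rw [pow_succ', mul_assoc, D.p₁_mul, D.p₀_z_sub_one, D.p₀_z_sub_one_pow_mul a (by omega)]
  ring

theorem ω_eq_zero {u v : R} (hu : D.p₀ u = 0) (hv : D.p₀ v = 0) : D.ω u v = 0 := by
  rw [ω, hu, hv]
  ring

/-- The generator `z^a - 1` of the maximal ideal satisfies, for `a ≠ 0`, the same relation as `X`
up to the sign of `β`. -/
theorem three_eq {a : ZMod 3} (ha : a ≠ 0) :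
    3 = 2 * (D.z a - 1) ^ 2 + (D.z a - 1) ^ 3 + β * D.X ^ (c - 1) := by
  have h := D.mul_X_pow_eq_zero (u := D.z a - 1) (by rw [map_sub, D.p₀_z, map_one, sub_self])
  linear_combination (2 - D.z a) * D.z_sum ha - β * h

omit D in
theorem carry_zero_right (i : ZMod 3) : carry i 0 = 0 := by
  revert i
  decide

omit D in
theorem carry_add_carry {a : ZMod 3} (ha : a ≠ 0) : carry a a + carry (a + a) a = a.val := by
  revert a
  decide

end Uniserial

namespace Model

variable {c β : ℕ} {R : Type*} [CommRing R] {D : Uniserial c β R} {α : ℕ}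

/-- The element of the model given by an element of the normal subgroup `R × 𝔽₃`. -/
def vec (D : Uniserial c β R) (α : ℕ) (u : R) (t : ZMod 3) : Model D α := ⟨0, u, t⟩

@[simp] theorem vec_i (u : R) (t : ZMod 3) : (vec D α u t).i = 0 := rfl
@[simp] theorem vec_u (u : R) (t : ZMod 3) : (vec D α u t).u = u := rfl
@[simp] theorem vec_t (u : R) (t : ZMod 3) : (vec D α u t).t = t := rfl

theorem eq_vec {g : Model D α} (hg : g.i = 0) : g = vec D α g.u g.t := by
  ext <;> simp [hg]

theorem vec_zero : vec D α 0 0 = 1 := rfl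

theorem vec_mul_vec (u v : R) (t s : ZMod 3) :
    vec D α u t * vec D α v s = vec D α (u + v) (t + s - D.ω u v) := by
  ext
  · simp
  · simp [mul_u, carry_zero_left, D.z_zero]
  · simp [mul_t', D.z_zero]

theorem vec_inv (u : R) (t : ZMod 3) : (vec D α u t)⁻¹ = vec D α (-u) (-t) := by
  rw [inv_eq_iff_mul_eq_one, vec_mul_vec, ← vec_zero, ω, map_neg, map_neg]
  congr 1
  · ring
  · ring

theorem vec_pow (u : R) (t : ZMod 3) (n : ℕ) :
    vec D α u t ^ n = vec D α (n * u) (n * t) := by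
  induction n with
  | zero => simp [vec_zero]
  | succ n ih =>
    rw [pow_succ, ih, vec_mul_vec, ω, D.p₁_mul, map_mul, D.p₁_natCast]
    congr 1
    · push_cast; ring
    · push_cast; ring

theorem comm_vec_vec (u v : R) (t s : ZMod 3) :
    comm (vec D α u t) (vec D α v s) = vec D α 0 (D.ω u v) := by
  have h3 : (3 : ZMod 3) = 0 := rfl
  rw [comm_eq_iff, vec_mul_vec, vec_mul_vec, vec_mul_vec, ω, ω, ω, map_zero, map_zero]
  congr 1
  · ring
  · linear_combination (D.p₀ u * D.p₁ v - D.p₁ u * D.p₀ v) * h3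

theorem commute_vec_vec {u v : R} {t s : ZMod 3} (h : D.ω u v = 0) :
    Commute (vec D α u t) (vec D α v s) := by
  rw [← comm_eq_one_iff, comm_vec_vec, h, vec_zero]

theorem vec_mul {X : Model D α} (h₀ : D.p₀ X.u = 0) (h₁ : D.p₁ X.u = 0) (u : R) (t : ZMod 3) :
    vec D α u t * X = X * vec D α (D.z X.i * u) t := by
  ext
  · simp
  · simp only [mul_u, vec_i, vec_u, D.z_zero, carry_zero_left, carry_zero_right]
    push_cast
    ring
  · simp only [mul_t, vec_i, vec_u, vec_t, h₀, h₁]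
    ring

theorem comm_vec_left (g : Model D α) (u : R) (t : ZMod 3) :
    comm (vec D α u t) g = vec D α ((D.z g.i - 1) * u)
      ((g.i * D.p₀ u + D.p₁ u) * D.p₀ g.u - D.p₀ u * D.p₁ g.u - g.i * D.p₀ u ^ 2) := by
  have h3 : (3 : ZMod 3) = 0 := rfl
  rw [comm_eq_iff, mul_assoc, vec_mul_vec]
  ext
  · simp
  · simp only [mul_u, vec_i, vec_u, D.z_zero, carry_zero_left, carry_zero_right]
    push_cast
    ring
  · simp only [mul_t, vec_i, vec_u, vec_t, ω, map_add, map_mul, D.p₁_mul, map_sub, D.p₀_z, D.p₁_z,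
      map_one, D.p₁_one]
    linear_combination (D.p₀ u * D.p₁ g.u - (g.i * D.p₀ u + D.p₁ u) * D.p₀ g.u) * h3

theorem comm_vec {X : Model D α} (h₀ : D.p₀ X.u = 0) (h₁ : D.p₁ X.u = 0) (u : R) (t : ZMod 3) :
    comm (vec D α u t) X = vec D α ((D.z X.i - 1) * u) (-X.i * D.p₀ u ^ 2) := by
  rw [comm_vec_left, h₀, h₁]
  congr 1
  ring

theorem pow_three_i (X : Model D α) : (X ^ 3).i = 0 := by
  have h3 : (3 : ZMod 3) = 0 := rfl
  rw [pow_succ, sq, mul_i, mul_i]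
  linear_combination X.i * h3

theorem pow_three_u {X : Model D α} (hX : X.i ≠ 0) :
    (X ^ 3).u = (β * X.u + α * X.i.val) * D.X ^ (c - 1) := by
  have h := congrArg (Int.cast : ℤ → R) (carry_add_carry hX)
  push_cast at h
  rw [pow_succ, sq, mul_u, mul_u, mul_i]
  linear_combination (α * carry X.i X.i : R) * D.z_mul_X_pow X.i + X.u * D.z_sum hX
    + α * D.X ^ (c - 1) * h

theorem pow_three_t (X : Model D α) : (X ^ 3).t = - X.i * D.p₀ X.u ^ 2 := by
  have h3 : (3 : ZMod 3) = 0 := rfl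
  rw [pow_succ, sq, mul_t, mul_t, mul_p₀, mul_p₁]
  linear_combination (X.t - X.i * D.p₀ X.u ^ 2) * h3

/-- The elements `X = (a, w, r)`, with `w` in the square of the maximal ideal, and `Y = (0, v, 0)`
of the model satisfy the relations of `G_c(α', β')` under two congruences modulo `3`. -/
def sys {α' β' : ℕ} (X : Model D α) (hX : X.i ≠ 0) (h₀ : D.p₀ X.u = 0) (h₁ : D.p₁ X.u = 0)
    (v : R) (hα : α' * X.i ^ (c - 1) * D.p₀ v = (X.i * α : ZMod 3))
    (hβ : (β : ZMod 3) = β' * X.i ^ (c - 1)) : PcSystem c α' β' (Model D α) where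
  x := X
  y := vec D α v 0
  t := vec D α 0 (X.i * D.p₀ v ^ 2)
  s j := vec D α ((D.z X.i - 1) ^ (j - 1) * v) (if j = 2 then -X.i * D.p₀ v ^ 2 else 0)
  s_eq_one j hj := by
    have hc := D.five_le
    rw [D.z_sub_one_pow_eq_zero _ (by omega), if_neg (by omega), zero_mul, vec_zero]
  comm_y_x := by rw [comm_vec h₀ h₁, if_pos rfl, pow_one]
  comm_s₂_y := by
    rw [comm_vec_vec, ω, pow_one, D.p₁_mul, map_mul, D.p₀_z_sub_one, map_sub, D.p₁_z, D.p₁_one]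
    congr 1
    ring
  comm_s_x j hj := by
    obtain ⟨k, rfl⟩ := Nat.exists_eq_add_of_le' hj
    rw [comm_vec h₀ h₁, if_neg (by omega)]
    congr 1
    · rw [show k + 2 - 1 = k + 1 by omega, show k + 2 + 1 - 1 = k + 1 + 1 by omega]
      ring
    · rw [D.p₀_z_sub_one_pow_mul _ (by omega)]
      ring
  comm_s_y j hj := by
    refine commute_vec_vec ?_
    rw [ω, D.p₀_z_sub_one_pow_mul _ (by omega), D.p₁_z_sub_one_pow_mul _ (by omega)]
    ring
  comm_t_x := by
    rw [← comm_eq_one_iff, comm_vec h₀ h₁, map_zero, ← vec_zero]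
    congr 1
    ring
  comm_t_y := commute_vec_vec (by rw [ω, map_zero, map_zero]; ring)
  comm_s_s i j hi hj := by
    exact commute_vec_vec (D.ω_eq_zero (D.p₀_z_sub_one_pow_mul _ (by omega) _)
      (D.p₀_z_sub_one_pow_mul _ (by omega) _))
  comm_s_t j hj := commute_vec_vec (by rw [ω, map_zero, map_zero]; ring)
  pow_s j hj := by
    obtain ⟨k, rfl⟩ := Nat.exists_eq_add_of_le' hj
    have h3 : (3 : ZMod 3) = 0 := rfl
    have h := D.mul_X_pow_eq_zero (D.p₀_z_sub_one X.i)
    rw [vec_pow, vec_pow, vec_mul_vec, if_neg (c := k + 2 + 2 = 2) (by omega),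
      if_neg (c := k + 2 + 3 = 2) (by omega), D.ω_eq_zero]
    congr 1
    · rw [show k + 2 - 1 = k + 1 by omega, show k + 2 + 2 - 1 = k + 3 by omega,
        show k + 2 + 3 - 1 = k + 4 by omega]
      push_cast
      linear_combination (D.z X.i - 1) ^ (k + 1) * v * D.three_eq hX
        + (D.z X.i - 1) ^ k * v * β * h
    · push_cast
      rw [h3]
      ring
    · rw [map_mul, D.p₀_z_sub_one_pow_mul _ (by omega), mul_zero]
    · exact D.p₀_z_sub_one_pow_mul _ (by omega) _
  pow_t := by
    have h3 : (3 : ZMod 3) = 0 := rfl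
    rw [vec_pow, ← vec_zero]
    congr 1
    · ring
    · push_cast
      rw [h3, zero_mul]
  pow_x := by
    have hc := D.five_le
    obtain ⟨q, hq, hq'⟩ := D.exists_z_sub_one X.i
    rw [eq_vec (pow_three_i X), pow_three_u hX, pow_three_t, vec_pow, if_neg (by omega), h₀]
    have h : (β * X.u + α * X.i.val) * D.X ^ (c - 1) = (α' * q ^ (c - 1) * v) * D.X ^ (c - 1) := by
      rw [D.mul_X_pow_inj, map_mul, map_mul, map_add, map_mul, map_mul, map_pow, map_natCast,
        map_natCast, map_natCast, map_natCast, h₀, hq', hα, ZMod.natCast_zmod_val]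
      ring
    rw [h, hq, mul_pow]
    congr 1
    ring
  pow_y := by
    have hc := D.five_le
    obtain ⟨q, hq, hq'⟩ := D.exists_z_sub_one X.i
    have h : (β : R) * D.X ^ (c - 1) = (β' * q ^ (c - 1)) * D.X ^ (c - 1) := by
      rw [D.mul_X_pow_inj]
      simp only [map_mul, map_pow, map_natCast, hq', hβ]
    rw [vec_pow, vec_pow, vec_pow, vec_mul_vec, vec_mul_vec, if_neg (by omega), if_neg (by omega),
      if_neg (by omega), D.ω_eq_zero, D.ω_eq_zero]
    congr 1
    · have h' : (D.z X.i - 1) ^ (c - 1) = D.X ^ (c - 1) * q ^ (c - 1) := by rw [hq, mul_pow]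
      push_cast
      rw [h']
      linear_combination v * D.three_eq hX + v * h
    · ring
    all_goals
      simp only [map_add, map_mul (D.p₀) (Nat.cast _), D.p₀_z_sub_one_pow_mul X.i (n := c - 1)
        (by omega), D.p₀_z_sub_one_pow_mul X.i (n := 4 - 1) (by omega),
        D.p₀_z_sub_one_pow_mul X.i (n := 3 - 1) (by omega), mul_zero, add_zero]

end Model

namespace Model

variable {c β : ℕ} {R : Type*} [CommRing R] (D : Uniserial c β R) (α : ℕ)

/-- The generator `x` of the model. -/
def genX : Model D α := ⟨1, 0, 0⟩

/-- The standard system of the model. -/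
def stdSys : PcSystem c α β (Model D α) :=
  sys (genX D α) one_ne_zero (map_zero _) (map_zero _) 1 (by simp [genX]) (by simp [genX])

theorem stdSys_x : (stdSys D α).x = genX D α := rfl
theorem stdSys_y : (stdSys D α).y = vec D α 1 0 := rfl
theorem stdSys_t : (stdSys D α).t = vec D α 0 1 := by
  change vec D α 0 _ = _
  simp [genX]

theorem stdSys_s {j : ℕ} (hj : 3 ≤ j) : (stdSys D α).s j = vec D α (D.X ^ (j - 1)) 0 := by
  change vec D α _ _ = _
  rw [if_neg (by omega)]
  simp [genX, D.z_one]

theorem pow_i (g : Model D α) (n : ℕ) : (g ^ n).i = n * g.i := by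
  induction n with
  | zero => simp
  | succ n ih => rw [pow_succ, mul_i, ih]; push_cast; ring

theorem closure_eq_top : Subgroup.closure {genX D α, vec D α 1 0} = ⊤ := by
  set K := Subgroup.closure {genX D α, vec D α 1 0}
  have hx : genX D α ∈ K := Subgroup.subset_closure (by simp)
  have hy : vec D α 1 0 ∈ K := Subgroup.subset_closure (by simp)
  have ht (t : ZMod 3) : vec D α 0 t ∈ K := by
    have h := pow_mem ((stdSys D α).t_mem hx hy) t.val
    rwa [stdSys_t, vec_pow, mul_zero, mul_one, ZMod.natCast_zmod_val] at h
  have hsplit (u : R) (t : ZMod 3) : vec D α u t = vec D α u 0 * vec D α 0 t := by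
    rw [vec_mul_vec, ω, map_zero, map_zero]
    congr 1 <;> ring
  have hdrop {u : R} {t : ZMod 3} (h : vec D α u t ∈ K) : vec D α u 0 ∈ K := by
    rw [hsplit] at h
    exact (Subgroup.mul_mem_cancel_right K (ht t)).1 h
  let S : AddSubgroup R :=
    { carrier := {u | vec D α u 0 ∈ K}
      zero_mem' := K.one_mem
      add_mem' := by
        intro u v hu hv
        have h := K.mul_mem hu hv
        rw [vec_mul_vec] at h
        exact hdrop h
      neg_mem' := by
        intro u hu
        have h := K.inv_mem hu
        rw [vec_inv] at h
        exact hdrop h }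
  have hS : S = ⊤ := by
    refine D.eq_top S hy fun u hu => ?_
    have h := comm_mem (show vec D α u 0 ∈ K from hu) hx
    rw [comm_vec (map_zero _) (map_zero _)] at h
    have h' := hdrop h
    rwa [show (genX D α).i = 1 from rfl, D.z_one, add_sub_cancel_left] at h'
  have hvec (u : R) (t : ZMod 3) : vec D α u t ∈ K := by
    rw [hsplit]
    exact K.mul_mem (hS ▸ AddSubgroup.mem_top u : u ∈ S) (ht t)
  rw [eq_top_iff]
  rintro g -
  have hg : (genX D α ^ (-g.i).val * g).i = 0 := by
    rw [mul_i, pow_i, show (genX D α).i = 1 from rfl, ZMod.natCast_zmod_val]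
    ring
  rw [← Subgroup.mul_mem_cancel_left K (K.pow_mem hx (-g.i).val), eq_vec hg]
  exact hvec _ _

/-- The coordinates of the model. -/
def equivProd : Model D α ≃ ZMod 3 × R × ZMod 3 where
  toFun g := (g.i, g.u, g.t)
  invFun p := ⟨p.1, p.2.1, p.2.2⟩
  left_inv _ := rfl
  right_inv _ := rfl

theorem card_eq : Nat.card (Model D α) = 3 ^ (c + 2) := by
  rw [Nat.card_congr (equivProd D α), Nat.card_prod, Nat.card_prod, D.card_eq, Nat.card_zmod]
  ring

/-- The homomorphism from the model onto the first coordinate. -/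
def iHom :
    Model D α →* Multiplicative (ZMod 3) where
  toFun g := .ofAdd g.i
  map_one' := rfl
  map_mul' _ _ := rfl

/-- The homomorphism from the model onto the residue class of the second coordinate. -/
def jHom :
    Model D α →* Multiplicative (ZMod 3) where
  toFun g := .ofAdd (D.p₀ g.u)
  map_one' := by simp
  map_mul' a b := by simp

variable {D α} in
theorem of_mem_commutator {g : Model D α} (hg : g ∈ commutator (Model D α)) : g.i = 0 ∧ D.p₀ g.u = 0 :=
  ⟨Abelianization.commutator_subset_ker (iHom D α) hg,
    Abelianization.commutator_subset_ker (jHom D α) hg⟩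

end Model

section presented

variable {c : ℕ} (hc : 5 ≤ c) (α : Fin 2) (β : Fin 3)

include hc

theorem QGroup.finite : Finite (QGroup c α β) :=
  ((QGroup.sys α β hc).card_le (by omega) (QGroup.closure_eq_top α β hc)).1

theorem QGroup.card_le : Nat.card (QGroup c α β) ≤ 3 ^ (c + 2) :=
  ((QGroup.sys α β hc).card_le (by omega) (QGroup.closure_eq_top α β hc)).2

theorem PcSystem.lift_x {G : Type*} [Group G] (P : PcSystem c α β G) :
    P.lift hc (QGroup.sys α β hc).x = P.x := P.lift_gen_wx

theorem PcSystem.lift_y {G : Type*} [Group G] (P : PcSystem c α β G) :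
    P.lift hc (QGroup.sys α β hc).y = P.y := P.lift_gen_wy

theorem PcSystem.lift_s {G : Type*} [Group G] (P : PcSystem c α β G) {j : ℕ} (hj : 2 ≤ j) :
    P.lift hc ((QGroup.sys α β hc).s j) = P.s j := P.lift_gen_ws hj

/-- A homomorphism from a presented group is bijective if its image generates a group of the
right order. -/
theorem PcSystem.lift_bijective {G : Type*} [Group G] (P : PcSystem c α β G)
    (htop : Subgroup.closure {P.x, P.y} = ⊤) (hcard : Nat.card G = 3 ^ (c + 2)) :
    Function.Bijective (P.lift hc) := by
  have := QGroup.finite hc α β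
  refine Function.Surjective.bijective_of_nat_card_le ?_ ((QGroup.card_le hc α β).trans hcard.ge)
  rw [← MonoidHom.range_eq_top, eq_top_iff, ← htop, Subgroup.closure_le]
  rintro _ (rfl | rfl)
  · exact ⟨_, P.lift_x hc α β⟩
  · exact ⟨_, P.lift_y hc α β⟩

/-- The model of `G_c(α, β)` over a quotient of the Eisenstein integers. -/
abbrev QModel : Type := Model (eisUniserial c β hc) α

/-- The isomorphism from the presented group to the model. -/
noncomputable def QGroup.equivModel : QGroup c α β ≃* QModel hc α β :=
  MulEquiv.ofBijective ((Model.stdSys (eisUniserial c β hc) α).lift hc)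
    (PcSystem.lift_bijective hc α β _ (Model.closure_eq_top _ _) (Model.card_eq _ _))

theorem QGroup.card_eq : Nat.card (QGroup c α β) = 3 ^ (c + 2) := by
  rw [Nat.card_congr (QGroup.equivModel hc α β).toEquiv, Model.card_eq]

theorem QGroup.s_last_ne_one : (QGroup.sys α β hc).s c ≠ 1 := by
  intro h
  have h' := congrArg ((Model.stdSys (eisUniserial c β hc) α).lift hc) h
  rw [PcSystem.lift_s hc α β _ (by omega), map_one, Model.stdSys_s _ _ (by omega)] at h'
  exact (eisUniserial c β hc).X_pow_pred (congrArg Model.u h')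

theorem QGroup.hasClass : HasClass (QGroup c α β) c := by
  have hbot := (QGroup.sys α β hc).lowerCentralSeries_eq_bot (by omega)
    (QGroup.closure_eq_top α β hc)
  have hn : Group.IsNilpotent (QGroup c α β) := Subgroup.nilpotent_iff_lowerCentralSeries.2 ⟨c, hbot⟩
  refine ⟨hn, le_antisymm (Subgroup.lowerCentralSeries_eq_bot_iff_nilpotencyClass_le.1 hbot) ?_⟩
  by_contra hlt
  have h : Group.nilpotencyClass (QGroup c α β) ≤ c - 1 := by omega
  rw [← Subgroup.lowerCentralSeries_eq_bot_iff_nilpotencyClass_le] at h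
  have hmem := (QGroup.sys α β hc).s_mem_lowerCentralSeries (j := c) (by omega)
  rw [h, Subgroup.mem_bot] at hmem
  exact QGroup.s_last_ne_one hc α β hmem

theorem QGroup.hasCoclass : HasCoclass 3 (QGroup c α β) 2 :=
  ⟨c + 2, c, QGroup.card_eq hc α β, QGroup.hasClass hc α β, rfl⟩

theorem QGroup.isMetabelian : IsMetabelian (QGroup c α β) := by
  constructor
  · intro h
    have hmem := (QGroup.sys α β hc).s_mem_commutator (j := c) (by omega)
    rw [derivedSeries_one] at h
    rw [h, Subgroup.mem_bot] at hmem
    exact QGroup.s_last_ne_one hc α β hmem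
  · let e := QGroup.equivModel hc α β
    rw [show (2 : ℕ) = 1 + 1 from rfl, derivedSeries_succ, derivedSeries_one,
      Subgroup.commutator_eq_bot_iff_le_centralizer]
    intro g hg
    rw [Subgroup.mem_centralizer_iff]
    intro h hh
    have key {g : QGroup c α β} (hg : g ∈ commutator (QGroup c α β)) :
        e g ∈ commutator (QModel hc α β) := by
      have hm := Subgroup.mem_map_of_mem e.toMonoidHom hg
      rw [commutator_def, Subgroup.map_commutator] at hm
      exact Subgroup.commutator_mono le_top le_top hm
    obtain ⟨hi, hp⟩ := Model.of_mem_commutator (key hg)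
    obtain ⟨hi', hp'⟩ := Model.of_mem_commutator (key hh)
    apply e.injective
    rw [map_mul, map_mul, Model.eq_vec hi, Model.eq_vec hi']
    exact Model.commute_vec_vec ((eisUniserial c β hc).ω_eq_zero hp' hp)

end presented

/-! ### Quotients by terms of the lower central series -/

/-- The quotient of `G_{c'}(α, β)` by `γ_{c + 1}` is the group presented by the truncated
relations: any group `K` generated by a system of parameter `c`, and mapping to the quotient. -/
theorem QGroup.nonempty_quotient_mulEquiv {c c' : ℕ} (hc : 3 ≤ c) (h : c < c') (hc' : 5 ≤ c')
    (α : Fin 2) (β : Fin 3) {K : Type*} [Group K] (P : PcSystem c 0 0 K)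
    (htop : Subgroup.closure {P.x, P.y} = ⊤)
    (f : K →* QGroup c' α β ⧸ (⊤ : Subgroup (QGroup c' α β)).lowerCentralSeries c)
    (hfx : f P.x = QuotientGroup.mk (QGroup.sys α β hc').x)
    (hfy : f P.y = QuotientGroup.mk (QGroup.sys α β hc').y) :
    Nonempty (QGroup c' α β ⧸ (⊤ : Subgroup (QGroup c' α β)).lowerCentralSeries c ≃* K) := by
  let g₀ : QGroup c' α β →* K := (P.extend h α β).lift hc'
  have hx : g₀ (QGroup.sys α β hc').x = P.x := PcSystem.lift_x hc' α β _
  have hy : g₀ (QGroup.sys α β hc').y = P.y := PcSystem.lift_y hc' α β _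
  let g := QuotientGroup.lift ((⊤ : Subgroup (QGroup c' α β)).lowerCentralSeries c) g₀ (by
    intro a ha
    have h1 := Subgroup.mem_map_of_mem g₀ ha
    rw [Subgroup.map_lowerCentralSeries] at h1
    have h2 : g₀ a ∈ (⊤ : Subgroup K).lowerCentralSeries c :=
      Subgroup.lowerCentralSeries_mono c le_top h1
    rwa [P.lowerCentralSeries_eq_bot hc htop, Subgroup.mem_bot] at h2)
  refine ⟨g.toMulEquiv f ?_ ?_⟩
  · refine QuotientGroup.monoidHom_ext _
      (MonoidHom.eq_of_eqOn_dense (QGroup.closure_eq_top α β hc') ?_)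
    rintro _ (rfl | rfl)
    · exact (congrArg f hx).trans hfx
    · exact (congrArg f hy).trans hfy
  · refine MonoidHom.eq_of_eqOn_dense htop ?_
    rintro _ (rfl | rfl)
    · exact (congrArg g hfx).trans hx
    · exact (congrArg g hfy).trans hy

/-- The system of parameter `c` in the quotient of `G_{c'}(α, β)` by `γ_{c + 1}`. -/
def QGroup.quotientSys {c c' : ℕ} (hc : 2 ≤ c) (h : c < c') (hc' : 5 ≤ c') (α : Fin 2)
    (β : Fin 3) :
    PcSystem c 0 0 (QGroup c' α β ⧸ (⊤ : Subgroup (QGroup c' α β)).lowerCentralSeries c) :=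
  ((QGroup.sys α β hc').map (QuotientGroup.mk' _)).truncate h fun j hj =>
    (QuotientGroup.eq_one_iff _).2 (Subgroup.lowerCentralSeries_antitone _
      (by omega : c ≤ j - 1) ((QGroup.sys α β hc').s_mem_lowerCentralSeries (by omega)))

theorem QGroup.mainline {c : ℕ} (hc : 5 ≤ c) : Nonempty (QGroup (c + 1) 0 0 ⧸
    (⊤ : Subgroup (QGroup (c + 1) 0 0)).lowerCentralSeries c ≃* QGroup c 0 0) := by
  let P := QGroup.quotientSys (c' := c + 1) (by omega) (Nat.lt_succ_self c) (by omega) 0 0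
  exact QGroup.nonempty_quotient_mulEquiv (by omega) (Nat.lt_succ_self c) (by omega) 0 0
    (QGroup.sys 0 0 hc) (QGroup.closure_eq_top 0 0 hc) (PcSystem.lift (α := 0) (β := 0) hc P)
    (PcSystem.lift_x hc 0 0 P) (PcSystem.lift_y hc 0 0 P)

section root

/-- The class of a generator in `SmallGroup(243, 6)`. -/
def rootOf (g : RootGen) : Root := PresentedGroup.of g

theorem rootMk_eq {l r : FreeGroup RootGen} (h : RootEq l r) :
    (PresentedGroup.mk {w : FreeGroup RootGen | ∃ l r, RootEq l r ∧ w = l * r⁻¹} l : Root) =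
      PresentedGroup.mk _ r := by
  have h' : (PresentedGroup.mk {w : FreeGroup RootGen | ∃ l r, RootEq l r ∧ w = l * r⁻¹}
    (l * r⁻¹) : Root) = 1 := PresentedGroup.one_of_mem ⟨l, r, h, rfl⟩
  rwa [map_mul, map_inv, mul_inv_eq_one] at h'

theorem rootOf_commute {g h : RootGen} (H : RootEq (comm (.of g) (.of h)) 1) :
    Commute (rootOf g) (rootOf h) := by
  rw [← comm_eq_one_iff]
  exact (map_comm _ _ _).symm.trans ((rootMk_eq H).trans (map_one _))

/-- The generators `s_j` of `SmallGroup(243, 6)`, with `s_j = 1` for `j ≥ 4`. -/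
def rootS : ℕ → Root
  | 2 => rootOf .s₂
  | 3 => rootOf .s₃
  | _ => 1

/-- `SmallGroup(243, 6)` satisfies the parametrized relations for `c = 3` and `α = β = 0`. -/
def rootSys : PcSystem 3 0 0 Root where
  x := rootOf .x
  y := rootOf .y
  t := rootOf .t₃
  s := rootS
  s_eq_one j hj := by
    obtain ⟨k, rfl⟩ : ∃ k, j = k + 4 := ⟨j - 4, by omega⟩
    rfl
  comm_y_x := ((map_comm _ _ _).symm.trans (rootMk_eq .def_s₂).symm)
  comm_s₂_y := ((map_comm _ _ _).symm.trans (rootMk_eq .def_t₃).symm)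
  comm_s_x j hj := by
    obtain rfl | rfl | ⟨k, rfl⟩ : j = 2 ∨ j = 3 ∨ ∃ k, j = k + 4 := by
      rcases lt_or_ge j 4 with h | h
      · omega
      · exact Or.inr (Or.inr ⟨j - 4, by omega⟩)
    · exact ((map_comm _ _ _).symm.trans (rootMk_eq .def_s₃).symm)
    · exact comm_eq_one_iff.2 (rootOf_commute .comm_s₃_x)
    · exact comm_eq_one_iff.2 (Commute.one_left _)
  comm_s_y j hj := by
    obtain rfl | ⟨k, rfl⟩ : j = 3 ∨ ∃ k, j = k + 4 := by
      rcases lt_or_ge j 4 with h | h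
      · omega
      · exact Or.inr ⟨j - 4, by omega⟩
    · exact rootOf_commute .comm_s₃_y
    · exact Commute.one_left _
  comm_t_x := rootOf_commute .comm_t₃_x
  comm_t_y := rootOf_commute .comm_t₃_y
  comm_s_s i j hi hj := by
    have h32 : Commute (rootS 3) (rootS 2) := rootOf_commute .comm_s₃_s₂
    have key (k : ℕ) : rootS (k + 4) = 1 := rfl
    rcases lt_or_ge i 4 with h | h
    · rcases lt_or_ge j 4 with h' | h'
      · obtain rfl | rfl : i = 2 ∨ i = 3 := by omega
        · obtain rfl | rfl : j = 2 ∨ j = 3 := by omega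
          · exact Commute.refl _
          · exact h32.symm
        · obtain rfl | rfl : j = 2 ∨ j = 3 := by omega
          · exact h32
          · exact Commute.refl _
      · obtain ⟨k, rfl⟩ := Nat.exists_eq_add_of_le' h'
        exact Commute.one_right _
    · obtain ⟨k, rfl⟩ := Nat.exists_eq_add_of_le' h
      exact Commute.one_left _
  comm_s_t j hj := by
    obtain rfl | rfl | ⟨k, rfl⟩ : j = 2 ∨ j = 3 ∨ ∃ k, j = k + 4 := by
      rcases lt_or_ge j 4 with h | h
      · omega
      · exact Or.inr (Or.inr ⟨j - 4, by omega⟩)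
    · exact (rootOf_commute .comm_t₃_s₂).symm
    · exact (rootOf_commute .comm_t₃_s₃).symm
    · exact Commute.one_left _
  pow_s j hj := by
    obtain rfl | rfl | ⟨k, rfl⟩ : j = 2 ∨ j = 3 ∨ ∃ k, j = k + 4 := by
      rcases lt_or_ge j 4 with h | h
      · omega
      · exact Or.inr (Or.inr ⟨j - 4, by omega⟩)
    · have h : rootS 2 ^ 3 = 1 := rootMk_eq .pow_s₂
      rw [h]
      simp [rootS]
    · have h : rootS 3 ^ 3 = 1 := rootMk_eq .pow_s₃
      rw [h]
      simp [rootS]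
    · simp [rootS]
  pow_t := rootMk_eq .pow_t₃
  pow_x := rootMk_eq .pow_x
  pow_y := by
    have h : rootOf .y ^ 3 = rootS 3 ^ 2 := rootMk_eq .pow_y
    rw [h, pow_zero, one_mul]
    simp [rootS]

theorem rootSys_closure : Subgroup.closure {rootSys.x, rootSys.y} = ⊤ := by
  set K := Subgroup.closure {rootSys.x, rootSys.y}
  have hx : rootSys.x ∈ K := Subgroup.subset_closure (by simp)
  have hy : rootSys.y ∈ K := Subgroup.subset_closure (by simp)
  rw [eq_top_iff, ← PresentedGroup.closure_range_of, Subgroup.closure_le]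
  rintro _ ⟨g, rfl⟩
  cases g with
  | x => exact hx
  | y => exact hy
  | t₃ => exact rootSys.t_mem hx hy
  | s₂ => exact rootSys.s_mem hx hy (j := 2) le_rfl
  | s₃ => exact rootSys.s_mem hx hy (j := 3) (by omega)

variable {G : Type*} [Group G]

/-- The elements of a system of parameter `3`, as images of the generators of
`SmallGroup(243, 6)`. -/
def PcSystem.rootGen (P : PcSystem 3 0 0 G) : RootGen → G
  | .x => P.x
  | .y => P.y
  | .s₂ => P.s 2
  | .s₃ => P.s 3
  | .t₃ => P.t

/-- The homomorphism from `SmallGroup(243, 6)` given by a system of parameter `3`. -/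
def PcSystem.rootLift (P : PcSystem 3 0 0 G) : Root →* G :=
  PresentedGroup.toGroup (f := P.rootGen) (by
    rintro _ ⟨l, r, h, rfl⟩
    rw [map_mul, map_inv, mul_inv_eq_one]
    have h4 (j : ℕ) : P.s (j + 4) = 1 := P.s_eq_one _ (by omega)
    cases h <;>
      simp only [map_comm, map_pow, map_one, FreeGroup.lift_apply_of, rootGen, comm_eq_one_iff]
    · exact P.comm_y_x.symm
    · exact (P.comm_s_x 2 le_rfl).symm
    · exact P.comm_s₂_y.symm
    · rw [P.pow_x, pow_zero]
    · rw [P.pow_y, pow_zero, one_mul, h4 0, one_mul]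
    · rw [P.pow_s 2 le_rfl, h4 0, h4 1, one_pow, one_mul]
    · rw [P.pow_s 3 (by omega), h4 1, h4 2, one_pow, one_mul]
    · exact P.pow_t
    · rw [← comm_eq_one_iff, P.comm_s_x 3 (by omega), h4 0]
    · exact P.comm_s_y 3 le_rfl
    · exact P.comm_t_x
    · exact P.comm_t_y
    · exact P.comm_s_s 3 2 (by omega) le_rfl
    · exact (P.comm_s_t 2 le_rfl).symm
    · exact (P.comm_s_t 3 (by omega)).symm)

theorem QGroup.isDescendant {c : ℕ} (hc : 5 ≤ c) (α : Fin 2) (β : Fin 3) :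
    IsDescendant (QGroup c α β) Root := by
  let P := QGroup.quotientSys (c := 3) (by omega) (by omega) hc α β
  exact ⟨3, QGroup.nonempty_quotient_mulEquiv le_rfl (by omega) hc α β rootSys rootSys_closure
    P.rootLift (FreeGroup.lift_apply_of ..) (FreeGroup.lift_apply_of ..)⟩

end root

/-! ### Isomorphisms between the presented groups -/

namespace Model

variable {c β : ℕ} {R : Type*} [CommRing R] {D : Uniserial c β R} {α : ℕ}

theorem inv_genX : (genX D α)⁻¹.i = -1 ∧ D.p₀ (genX D α)⁻¹.u = 0 ∧ D.p₁ (genX D α)⁻¹.u = 0 := by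
  have hu : (genX D α)⁻¹.u = -(α * carry (-1) 1 * D.X ^ (c - 1)) := by
    rw [inv_u']
    simp [genX]
  refine ⟨rfl, ?_, ?_⟩
  · rw [hu, map_neg, map_mul, D.p₀_X_pow_pred, mul_zero, neg_zero]
  · rw [hu, map_neg, D.p₁_mul, D.p₀_X_pow_pred, D.p₁_X_pow_pred, mul_zero, mul_zero, add_zero,
      neg_zero]

/-- The system in the model with `x` replaced by its inverse and `y` by `(0, v, 0)`. -/
def invSys (D : Uniserial c β R) (α : ℕ) {α' β' : ℕ} (v : R)
    (hα : α' * (-1) ^ (c - 1) * D.p₀ v = (-α : ZMod 3))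
    (hβ : (β : ZMod 3) = β' * (-1) ^ (c - 1)) : PcSystem c α' β' (Model D α) :=
  sys (genX D α)⁻¹ (by rw [inv_genX.1]; decide) inv_genX.2.1 inv_genX.2.2 v
    (by rw [inv_genX.1, hα, neg_one_mul]) (by rw [inv_genX.1, hβ])

/-- In a generating system of the model, `y` lies in the subgroup `R × 𝔽₃`, while `x` does not; so
an isomorphism preserves `⟨y, G'⟩`. This rests on `s_c ≠ 1`, which holds
because otherwise the group would be generated by a system of parameter `c - 1`, and too small. -/
theorem generating_i {α' β' : ℕ} (P : PcSystem c α' β' (Model D α))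
    (htop : Subgroup.closure {P.x, P.y} = ⊤) : P.s c ≠ 1 ∧ P.x.i ≠ 0 ∧ P.y.i = 0 := by
  have hc := D.five_le
  have hne : P.s c ≠ 1 := by
    intro h
    have h1 := ((P.truncate (c := c - 1) (by omega) (fun j hj => by
      obtain rfl | hj' : j = c ∨ c < j := by omega
      · exact h
      · exact P.s_eq_one j hj')).card_le (by omega) htop).2
    rw [card_eq] at h1
    have h2 : 3 ^ (c - 1 + 2) < 3 ^ (c + 2) := Nat.pow_lt_pow_right (by norm_num) (by omega)
    omega
  obtain ⟨hi₂, hp₂⟩ := of_mem_commutator (P.s_mem_commutator le_rfl)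
  have hs₃ : (P.s 3).i = 0 ∧ (P.s 3).u = (D.z P.x.i - 1) * (P.s 2).u := by
    rw [← P.comm_s_x 2 le_rfl, eq_vec hi₂, comm_vec_left]
    exact ⟨rfl, rfl⟩
  have hs (n : ℕ) : P.s (n + 4) = vec D α ((D.z P.x.i - 1) ^ (n + 2) * (P.s 2).u) 0 := by
    induction n with
    | zero =>
      rw [← P.comm_s_x 3 (by omega), eq_vec hs₃.1, comm_vec_left, hs₃.2]
      congr 1
      · ring
      · rw [D.p₁_mul, map_mul, D.p₀_z_sub_one, hp₂]
        ring
    | succ n ih =>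
      rw [← P.comm_s_x (n + 4) (by omega), ih, comm_vec_left, D.p₁_z_sub_one_pow_mul _ (by omega),
        D.p₀_z_sub_one_pow_mul _ (by omega)]
      congr 1 <;> ring
  have hn2 : (D.z P.x.i - 1) ^ 2 * (P.s 2).u ≠ 0 := by
    intro h
    apply hne
    have h1 := hs (c - 4)
    rw [pow_add, mul_assoc, h, mul_zero, vec_zero, Nat.sub_add_cancel (by omega)] at h1
    exact h1
  have hx : P.x.i ≠ 0 := by
    intro h
    rw [h, D.z_zero, sub_self] at hn2
    exact hn2 (by ring)
  refine ⟨hne, hx, ?_⟩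
  by_contra hy
  have h := comm_eq_one_iff.2 (P.comm_s_y 3 le_rfl)
  rw [eq_vec hs₃.1, comm_vec_left, hs₃.2] at h
  have hu : (D.z P.y.i - 1) * ((D.z P.x.i - 1) * (P.s 2).u) = 0 := congrArg Model.u h
  obtain h | h : P.y.i = P.x.i ∨ P.x.i + P.y.i = 0 := by
    generalize P.y.i = b at hy
    generalize P.x.i = a at hx
    revert a b
    decide
  · rw [h] at hu
    exact hn2 (by linear_combination hu)
  · -- here `z^b - 1 = -z^b (z^a - 1)`, since `z^a z^b = 1`
    have hz : D.z P.x.i * D.z P.y.i = 1 := by rw [← D.z_add, h, D.z_zero]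
    exact hn2 (by linear_combination (D.z P.x.i - 1) * (P.s 2).u * hz - D.z P.x.i * hu)

/-- The necessary conditions on the parameters for a generating system in the model. The first
equation compares the two expressions for the `R`-coordinate of `x ^ 3`, the second those of
`y ^ 3`; both become equations in `𝔽₃` since they are equations between multiples of
`X ^ (c - 1)`. -/
theorem generating_conditions {α' β' : ℕ} (P : PcSystem c α' β' (Model D α))
    (htop : Subgroup.closure {P.x, P.y} = ⊤) :
    P.x.i ≠ 0 ∧ D.p₀ P.y.u ≠ 0 ∧ α' * P.x.i ^ (c - 1) * D.p₀ P.y.u = (P.x.i * α : ZMod 3) ∧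
      (β : ZMod 3) = β' * P.x.i ^ (c - 1) := by
  have hc := D.five_le
  obtain ⟨hne, hx, hy⟩ := generating_i P htop
  have hu (n : ℕ) : (P.s (n + 2)).i = 0 ∧ (P.s (n + 2)).u = (D.z P.x.i - 1) ^ (n + 1) * P.y.u := by
    induction n with
    | zero =>
      rw [zero_add, ← P.comm_y_x, eq_vec hy, comm_vec_left]
      exact ⟨rfl, by simp⟩
    | succ n ih =>
      rw [← P.comm_s_x (n + 2) (by omega), eq_vec ih.1, comm_vec_left, ih.2]
      exact ⟨rfl, by simp only [vec_u]; ring⟩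
  have ht (n : ℕ) : (P.s (n + 4)).t = 0 := by
    rw [← P.comm_s_x (n + 3) (by omega), eq_vec (hu (n + 1)).1, comm_vec_left, (hu (n + 1)).2,
      D.p₁_z_sub_one_pow_mul _ (by omega), D.p₀_z_sub_one_pow_mul _ (by omega), vec_t]
    ring
  have hs (n : ℕ) : P.s (n + 4) = vec D α ((D.z P.x.i - 1) ^ (n + 3) * P.y.u) 0 := by
    rw [eq_vec (hu (n + 2)).1, (hu (n + 2)).2, ht]
  have hs₄ := hs 0
  have hsc := hs (c - 4)
  rw [Nat.sub_add_cancel (by omega), show c - 4 + 3 = c - 1 by omega] at hsc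
  obtain ⟨q, hq, hq'⟩ := D.exists_z_sub_one P.x.i
  have hpow : (D.z P.x.i - 1) ^ (c - 1) = q ^ (c - 1) * D.X ^ (c - 1) := by
    rw [hq, mul_pow, mul_comm]
  have hv : D.p₀ P.y.u ≠ 0 := by
    intro h
    apply hne
    rw [hsc, hpow, mul_right_comm, D.mul_X_pow_eq_zero (by rw [map_mul, h, mul_zero]), vec_zero]
  have hpx := P.pow_x
  have hpy := P.pow_y
  rw [hsc, vec_pow] at hpx
  rw [hsc, hs₄, eq_vec hy, eq_vec (hu 1).1, (hu 1).2, vec_pow, vec_pow, vec_pow, vec_mul_vec,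
    vec_mul_vec] at hpy
  have hpxt := congrArg Model.t hpx
  have hpxu := congrArg Model.u hpx
  have hpyu := congrArg Model.u hpy
  rw [pow_three_t, vec_t, mul_zero] at hpxt
  have hx₀ : D.p₀ P.x.u = 0 := by simpa [hx] using hpxt
  refine ⟨hx, hv, ?_, ?_⟩
  · have h : (β * P.x.u + α * P.x.i.val) * D.X ^ (c - 1)
        = (α' * q ^ (c - 1) * P.y.u) * D.X ^ (c - 1) := by
      rw [← pow_three_u hx, hpxu, vec_u, hpow]
      ring
    rw [D.mul_X_pow_inj, map_add, map_mul, map_mul, map_mul, map_mul, map_pow, map_natCast,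
      map_natCast, map_natCast, map_natCast, hx₀, hq', ZMod.natCast_zmod_val] at h
    linear_combination -h
  · have h : (β * P.y.u) * D.X ^ (c - 1) = (β' * q ^ (c - 1) * P.y.u) * D.X ^ (c - 1) := by
      simp only [vec_u, hpow] at hpyu
      push_cast at hpyu
      linear_combination hpyu - P.y.u * D.three_eq hx
    rw [D.mul_X_pow_inj, map_mul, map_mul, map_mul, map_pow, map_natCast, map_natCast, hq'] at h
    exact mul_right_cancel₀ hv h

end Model

section presented

variable {c : ℕ} (hc : 5 ≤ c)

include hc

theorem QGroup.closure_map_eq_top {α : Fin 2} {β : Fin 3} {G : Type*} [Group G]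
    (e : QGroup c α β ≃* G) :
    Subgroup.closure {e (QGroup.sys α β hc).x, e (QGroup.sys α β hc).y} = ⊤ := by
  have h := congrArg (Subgroup.map e.toMonoidHom) (QGroup.closure_eq_top α β hc)
  rw [MonoidHom.map_closure, Set.image_pair, Subgroup.map_top_of_surjective _ e.surjective] at h
  exact h

/-- The conditions which an isomorphism `G_c(α', β') ≃ G_c(α, β)` imposes on the parameters, where
`a` is the exponent of `x` in the image of `x`, and `b` that of `y` in the image of `y`, modulo the
commutator subgroup. -/
theorem QGroup.conditions_of_mulEquiv {α α' : Fin 2} {β β' : Fin 3}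
    (e : QGroup c α' β' ≃* QGroup c α β) (a b : ZMod 3)
    (ha : (QGroup.equivModel hc α β (e (QGroup.sys α' β' hc).x)).i = a)
    (hb : (eisUniserial c β hc).p₀
      (QGroup.equivModel hc α β (e (QGroup.sys α' β' hc).y)).u = b) :
    a ≠ 0 ∧ b ≠ 0 ∧ (α' : ℕ) * a ^ (c - 1) * b = (a * (α : ℕ) : ZMod 3) ∧
      ((β : ℕ) : ZMod 3) = (β' : ℕ) * a ^ (c - 1) := by
  let f := e.trans (QGroup.equivModel hc α β)
  have h := Model.generating_conditions ((QGroup.sys α' β' hc).map f.toMonoidHom)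
    (QGroup.closure_map_eq_top hc f)
  subst ha hb
  exact h

theorem QGroup.nonempty_mulEquiv_of_neg {α : Fin 2} {β β' : Fin 3} (he : Even c)
    (hβ : ((β : ℕ) : ZMod 3) = -(β' : ℕ)) : Nonempty (QGroup c α β' ≃* QGroup c α β) := by
  have hpow : (-1 : ZMod 3) ^ (c - 1) = -1 := (Nat.Even.sub_odd (by omega) he odd_one).neg_one_pow
  let P : PcSystem c α β' (QModel hc α β) :=
    Model.invSys (eisUniserial c β hc) α 1 (by rw [hpow, map_one]; ring) (by rw [hpow, hβ]; ring)
  have htop : Subgroup.closure {P.x, P.y} = ⊤ := by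
    rw [eq_top_iff, ← Model.closure_eq_top (eisUniserial c β hc) α, Subgroup.closure_le]
    rintro _ (rfl | rfl)
    · exact inv_mem_iff.1 (Subgroup.subset_closure (Set.mem_insert P.x _))
    · exact Subgroup.subset_closure (Set.mem_insert_of_mem _ rfl)
  exact ⟨(MulEquiv.ofBijective _ (PcSystem.lift_bijective hc α β' P htop (Model.card_eq _ _))).trans
    (QGroup.equivModel hc α β).symm⟩

theorem QGroup.isSigmaGroup {α : Fin 2} {β : Fin 3}
    (hα : ((α : ℕ) : ZMod 3) * (-1) ^ (c - 1) = (α : ℕ))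
    (hβ : ((β : ℕ) : ZMod 3) = (β : ℕ) * (-1) ^ (c - 1)) : IsSigmaGroup (QGroup c α β) := by
  let m := QGroup.equivModel hc α β
  let S := QGroup.sys α β hc
  let P : PcSystem c α β (QModel hc α β) :=
    Model.invSys (eisUniserial c β hc) α (-1) (by rw [hα, map_neg, map_one]; ring) hβ
  have hPy : P.y = (Model.vec (eisUniserial c β hc) α 1 0)⁻¹ := by
    rw [Model.vec_inv, neg_zero]
    rfl
  have hmx : m S.x = Model.genX _ _ := PcSystem.lift_x hc α β _
  have hmy : m S.y = Model.vec _ _ 1 0 := PcSystem.lift_y hc α β _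
  have htop : Subgroup.closure {P.x, P.y} = ⊤ := by
    rw [eq_top_iff, ← Model.closure_eq_top (eisUniserial c β hc) α, Subgroup.closure_le]
    rintro _ (rfl | rfl)
    · exact inv_mem_iff.1 (Subgroup.subset_closure (Set.mem_insert P.x _))
    · refine inv_mem_iff.1 ?_
      rw [← hPy]
      exact Subgroup.subset_closure (Set.mem_insert_of_mem _ rfl)
  let σ : MulAut (QGroup c α β) := (MulEquiv.ofBijective _
    (PcSystem.lift_bijective hc α β P htop (Model.card_eq _ _))).trans m.symm
  have hσx : σ S.x = S.x⁻¹ := by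
    apply m.injective
    rw [map_inv, hmx]
    exact (m.apply_symm_apply _).trans (PcSystem.lift_x hc α β P)
  have hσy : σ S.y = S.y⁻¹ := by
    apply m.injective
    rw [map_inv, hmy, ← hPy]
    exact (m.apply_symm_apply _).trans (PcSystem.lift_y hc α β P)
  have hinv (f : QGroup c α β →* Multiplicative (ZMod 3)) (g : QGroup c α β) :
      f (σ g) = (f g)⁻¹ := by
    have h : f.comp σ.toMonoidHom = f⁻¹ := by
      refine MonoidHom.eq_of_eqOn_dense (QGroup.closure_eq_top α β hc) ?_
      rintro _ (rfl | rfl)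
      · exact (congrArg f hσx).trans (map_inv _ _)
      · exact (congrArg f hσy).trans (map_inv _ _)
    exact DFunLike.congr_fun h g
  refine ⟨σ, ?_, hinv⟩
  refine orderOf_eq_prime ?_ ?_
  · have h : (σ ^ 2).toMonoidHom = MonoidHom.id _ := by
      refine MonoidHom.eq_of_eqOn_dense (QGroup.closure_eq_top α β hc) ?_
      rintro _ (rfl | rfl)
      · change σ (σ S.x) = S.x
        rw [hσx, map_inv, hσx, inv_inv]
      · change σ (σ S.y) = S.y
        rw [hσy, map_inv, hσy, inv_inv]
    ext g
    exact DFunLike.congr_fun h g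
  · intro h
    have h1 := hinv ((Model.iHom (eisUniserial c β hc) α).comp m.toMonoidHom) S.x
    rw [h] at h1
    have h2 : (m S.x).i = -(m S.x).i := h1
    rw [hmx] at h2
    revert h2
    change (1 : ZMod 3) = -1 → False
    decide

omit hc in
theorem natCast_fin_three_inj {β β' : Fin 3} (h : ((β : ℕ) : ZMod 3) = (β' : ℕ)) : β = β' := by
  revert β β'
  decide

omit hc in
theorem fin_two_eq_of_mul_eq {α α' : Fin 2} {a b : ZMod 3} (ha : a ≠ 0) (hb : b ≠ 0)
    (h : ((α : ℕ) : ZMod 3) * b = a * (α' : ℕ)) : α = α' := by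
  revert α α' a b
  decide

omit hc in
theorem pow_of_odd {a : ZMod 3} (ha : a ≠ 0) {n : ℕ} (hn : Odd n) : a ^ n = a := by
  obtain ⟨k, rfl⟩ := hn
  rw [pow_succ, pow_mul, show a ^ 2 = 1 by revert a; decide, one_pow, one_mul]

omit hc in
theorem pow_of_even {a : ZMod 3} (ha : a ≠ 0) {n : ℕ} (hn : Even n) : a ^ n = 1 := by
  obtain ⟨k, rfl⟩ := hn
  rw [← two_mul, pow_mul, show a ^ 2 = 1 by revert a; decide, one_pow]

theorem QGroup.eq_of_mulEquiv_of_odd (ho : Odd c) {α α' : Fin 2} {β β' : Fin 3}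
    (e : QGroup c α β ≃* QGroup c α' β') : α = α' ∧ β = β' := by
  obtain ⟨ha, hb, h₁, h₂⟩ := QGroup.conditions_of_mulEquiv hc e _ _ rfl rfl
  rw [pow_of_even ha (Nat.Odd.sub_odd ho odd_one), mul_one] at h₁ h₂
  exact ⟨fin_two_eq_of_mul_eq ha hb h₁, (natCast_fin_three_inj h₂).symm⟩

omit hc in
theorem tkt_eq_tkt_iff (α α' : Fin 2) (β β' : Fin 3) :
    tkt α β = tkt α' β' ↔ α = α' ∧ (β = 0 ↔ β' = 0) := by
  revert α α' β β'
  decide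

theorem QGroup.nonempty_mulEquiv_iff_of_even (he : Even c) (α α' : Fin 2) (β β' : Fin 3) :
    Nonempty (QGroup c α β ≃* QGroup c α' β') ↔ tkt α β = tkt α' β' := by
  rw [tkt_eq_tkt_iff]
  constructor
  · rintro ⟨e⟩
    obtain ⟨ha, hb, h₁, h₂⟩ := QGroup.conditions_of_mulEquiv hc e _ _ rfl rfl
    rw [pow_of_odd ha (Nat.Even.sub_odd (by omega) he odd_one)] at h₁ h₂
    generalize (QGroup.equivModel hc α' β' (e (QGroup.sys α β hc).x)).i = a at *
    generalize (eisUniserial c β' hc).p₀ _ = b at *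
    refine ⟨fin_two_eq_of_mul_eq ha (mul_ne_zero ha hb) (by rw [← mul_assoc, h₁]), ?_⟩
    clear h₁ e
    revert a β β'
    decide
  · rintro ⟨rfl, h⟩
    obtain rfl | h' : β = β' ∨ ((β' : ℕ) : ZMod 3) = -(β : ℕ) := by
      revert β β'
      decide
    · exact ⟨MulEquiv.refl _⟩
    · exact QGroup.nonempty_mulEquiv_of_neg hc he h'

theorem QGroup.isSigmaGroup_of_odd (ho : Odd c) (α : Fin 2) (β : Fin 3) :
    IsSigmaGroup (QGroup c α β) := by
  have h := (Nat.Odd.sub_odd ho odd_one).neg_one_pow (α := ZMod 3)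
  exact QGroup.isSigmaGroup hc (by rw [h, mul_one]) (by rw [h, mul_one])

theorem QGroup.isSigmaGroup_iff_of_even (he : Even c) (α : Fin 2) (β : Fin 3) :
    IsSigmaGroup (QGroup c α β) ↔ α = 0 ∧ β = 0 := by
  constructor
  · rintro ⟨σ, -, hσ⟩
    let m := QGroup.equivModel hc α β
    have hx : m (QGroup.sys α β hc).x = Model.genX _ _ := PcSystem.lift_x hc α β _
    have hy : m (QGroup.sys α β hc).y = Model.vec _ _ 1 0 := PcSystem.lift_y hc α β _
    have ha : (m (σ (QGroup.sys α β hc).x)).i = -1 := by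
      have h : (m (σ (QGroup.sys α β hc).x)).i = -(m (QGroup.sys α β hc).x).i :=
        hσ ((Model.iHom _ _).comp m.toMonoidHom) (QGroup.sys α β hc).x
      rw [h, hx]
      rfl
    have hb : (eisUniserial c β hc).p₀ (m (σ (QGroup.sys α β hc).y)).u = -1 := by
      have h : (eisUniserial c β hc).p₀ (m (σ (QGroup.sys α β hc).y)).u =
          -(eisUniserial c β hc).p₀ (m (QGroup.sys α β hc).y).u :=
        hσ ((Model.jHom _ _).comp m.toMonoidHom) (QGroup.sys α β hc).y
      rw [h, hy, Model.vec_u, map_one]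
    obtain ⟨-, -, h₁, h₂⟩ := QGroup.conditions_of_mulEquiv hc σ (-1) (-1) ha hb
    rw [pow_of_odd (by decide) (Nat.Even.sub_odd (by omega) he odd_one)] at h₁ h₂
    clear ha hb hx hy m hσ σ
    revert α β
    decide
  · rintro ⟨rfl, rfl⟩
    exact QGroup.isSigmaGroup hc (by simp) (by simp)

end presented

/-! ### The Artin transfer to a normal subgroup of index three -/

section transfer

variable {G : Type*} [Group G] {H : Subgroup G}

theorem transfer_eq_prod_section [H.FiniteIndex] [Fintype (G ⧸ H)] {A : Type*} [CommGroup A]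
    (φ : H →* A) (f : G ⧸ H → G) (hf : ∀ q, (f q : G ⧸ H) = q) (g : G) :
    MonoidHom.transfer φ g = ∏ q : G ⧸ H, φ ⟨(f q)⁻¹ * (g * f (g⁻¹ • q)), by
      rw [← QuotientGroup.eq, hf, ← smul_eq_mul, ← MulAction.Quotient.smul_coe, hf, smul_inv_smul]⟩ := by
  rw [MonoidHom.transfer_def φ ⟨Set.range f, Subgroup.isComplement_range_left hf⟩]
  refine Finset.prod_bij (fun q _ => q) (by simp) (by simp) (fun q _ => ⟨q, by simp⟩) fun q _ => ?_
  congr 2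
  rw [Subgroup.smul_apply_eq_smul_apply_inv_smul,
    Subgroup.IsComplement.leftQuotientEquiv_apply hf,
    Subgroup.IsComplement.leftQuotientEquiv_apply hf, smul_eq_mul]

variable [H.Normal] (hH : H.index = 3) {h : G} (hh : h ∉ H)

include hH

theorem pow_three_mem : h ^ 3 ∈ H := hH ▸ H.pow_index_mem h

include hh

theorem bijective_pow_mk : Function.Bijective fun i : Fin 3 => ((h ^ (i : ℕ) : G) : G ⧸ H) := by
  have hcard : Nat.card (G ⧸ H) = 3 := hH
  have : Finite (G ⧸ H) := Nat.finite_of_card_ne_zero (by omega)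
  have ho : orderOf (h : G ⧸ H) = 3 := by
    refine orderOf_eq_prime ?_ ?_
    · rw [← hcard]
      exact pow_card_eq_one'
    · rwa [Ne, QuotientGroup.eq_one_iff]
  refine (Nat.bijective_iff_injective_and_card _).2 ⟨fun i j hij => ?_, by rw [hcard, Nat.card_fin]⟩
  have h1 : (h : G ⧸ H) ^ (i : ℕ) = (h : G ⧸ H) ^ (j : ℕ) := hij
  rw [pow_inj_mod, ho, Nat.mod_eq_of_lt i.2, Nat.mod_eq_of_lt j.2] at h1
  exact Fin.ext h1

/-- The transfer of an element outside of `H` is its cube. -/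
theorem transfer_of_notMem [H.FiniteIndex] {A : Type*} [CommGroup A] (φ : H →* A) :
    MonoidHom.transfer φ h = φ ⟨h ^ 3, pow_three_mem hH⟩ := by
  have : Fintype (G ⧸ H) := H.fintypeQuotientOfFiniteIndex
  have hb := bijective_pow_mk hH hh
  let e := Equiv.ofBijective _ hb
  have h0 : h⁻¹ • ((h ^ 0 : G) : G ⧸ H) = ((h ^ ((2 : Fin 3) : ℕ) : G) : G ⧸ H) := by
    rw [MulAction.Quotient.smul_coe, QuotientGroup.eq]
    simpa [pow_succ', mul_assoc] using pow_three_mem hH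
  have h1 : h⁻¹ • ((h ^ 1 : G) : G ⧸ H) = ((h ^ ((0 : Fin 3) : ℕ) : G) : G ⧸ H) := by
    rw [MulAction.Quotient.smul_coe]
    simp
  have h2 : h⁻¹ • ((h ^ 2 : G) : G ⧸ H) = ((h ^ ((1 : Fin 3) : ℕ) : G) : G ⧸ H) := by
    rw [MulAction.Quotient.smul_coe]
    simp [sq]
  rw [transfer_eq_prod_section φ (fun q => h ^ (e.symm q : ℕ)) e.apply_symm_apply,
    ← hb.prod_comp, Fin.prod_univ_three, ← map_mul, ← map_mul]
  congr 1
  ext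
  simp only [Subgroup.coe_mul, Fin.val_zero, Fin.val_one, Fin.val_two, h0, h1, h2]
  group

/-- The transfer of an element of `H` is the product of its conjugates. -/
theorem transfer_of_mem [H.FiniteIndex] {A : Type*} [CommGroup A] (φ : H →* A) {g : G}
    (hg : g ∈ H) : MonoidHom.transfer φ g = φ ⟨g * (h⁻¹ * g * h) * (h⁻¹ * (h⁻¹ * g * h) * h), by
      have h1 : h⁻¹ * g * h ∈ H := by simpa using ‹H.Normal›.conj_mem g hg h⁻¹
      exact H.mul_mem (H.mul_mem hg h1) (by simpa using ‹H.Normal›.conj_mem _ h1 h⁻¹)⟩ := by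
  have : Fintype (G ⧸ H) := H.fintypeQuotientOfFiniteIndex
  have hb := bijective_pow_mk hH hh
  let e := Equiv.ofBijective _ hb
  have he (i : Fin 3) : e.symm ((h ^ (i : ℕ) : G) : G ⧸ H) = i := e.symm_apply_apply i
  have hs (k : G) : g⁻¹ • (k : G ⧸ H) = (k : G ⧸ H) := by
    rw [MulAction.Quotient.smul_coe, QuotientGroup.eq]
    simpa [mul_assoc] using ‹H.Normal›.conj_mem g hg k⁻¹
  rw [transfer_eq_prod_section φ (fun q => h ^ (e.symm q : ℕ)) e.apply_symm_apply,
    ← hb.prod_comp, Fin.prod_univ_three, ← map_mul, ← map_mul]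
  congr 1
  ext
  simp only [Subgroup.coe_mul, hs, he]
  simp only [Fin.val_zero, Fin.val_one, Fin.val_two]
  simp [sq, mul_assoc]

end transfer

theorem abelianization_of_eq_one_iff {G : Type*} [Group G] {H : Subgroup G} {g : G} (hg : g ∈ H) :
    (Abelianization.of ⟨g, hg⟩ : Abelianization H) = 1 ↔ g ∈ ⁅H, H⁆ := by
  rw [← MonoidHom.mem_ker, Abelianization.ker_of, ← Subgroup.map_subtype_commutator]
  simp [hg]

theorem exists_injective_of_pow_three {A : Type*} [Group A] {z : A} (hz : z ≠ 1) (hz3 : z ^ 3 = 1) :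
    ∃ ψ : Multiplicative (ZMod 3) →* A, Function.Injective ψ ∧ ψ (.ofAdd 1) = z := by
  let ψ : Multiplicative (ZMod 3) →* A :=
    { toFun k := z ^ k.toAdd.val
      map_one' := by simp
      map_mul' a b := by
        rw [toAdd_mul, ZMod.val_add, ← pow_add]
        exact (pow_eq_pow_mod _ hz3).symm }
  refine ⟨ψ, ?_, by simp [ψ, ZMod.val_one]⟩
  rw [injective_iff_map_eq_one]
  intro k hk
  have h1 : orderOf z ∣ k.toAdd.val := orderOf_dvd_of_pow_eq_one hk
  rw [orderOf_eq_prime hz3 hz] at h1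
  have h2 := ZMod.val_lt k.toAdd
  exact Multiplicative.toAdd.injective ((ZMod.val_eq_zero _).1 (Nat.eq_zero_of_dvd_of_lt h1 h2))

/-- If the transfers of two generators are powers of an element of order `3`, the exponents being
given by a homomorphism `F`, then the transfer kernel is the kernel of `F`. -/
theorem transferKernel_eq_ker {G : Type*} [Group G] {H : Subgroup G} [H.FiniteIndex] {x y : G}
    (htop : Subgroup.closure {x, y} = ⊤) (F : G →* Multiplicative (ZMod 3)) {z : Abelianization H}
    (hz : z ≠ 1) (hz3 : z ^ 3 = 1) {a b : ℕ} (hFx : F x = .ofAdd (a : ZMod 3))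
    (hFy : F y = .ofAdd (b : ZMod 3))
    (hx : MonoidHom.transfer (Abelianization.of : H →* Abelianization H) x = z ^ a)
    (hy : MonoidHom.transfer (Abelianization.of : H →* Abelianization H) y = z ^ b) :
    transferKernel H = F.ker := by
  obtain ⟨ψ, hψ, hψ1⟩ := exists_injective_of_pow_three hz hz3
  have hψn (n : ℕ) : ψ (.ofAdd (n : ZMod 3)) = z ^ n := by
    rw [← hψ1, ← map_pow, ← ofAdd_nsmul, nsmul_one]
  have h : MonoidHom.transfer (Abelianization.of : H →* Abelianization H) = ψ.comp F := by
    refine MonoidHom.eq_of_eqOn_dense htop ?_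
    rintro _ (rfl | rfl)
    · rw [hx, MonoidHom.comp_apply, hFx, hψn]
    · rw [hy, MonoidHom.comp_apply, hFy, hψn]
  rw [transferKernel, h]
  ext g
  rw [MonoidHom.mem_ker, MonoidHom.comp_apply, MonoidHom.mem_ker, map_eq_one_iff ψ hψ]

theorem transfer_pow_three_eq_one {G : Type*} [Group G] {H : Subgroup G} [H.FiniteIndex] {g : G}
    (hg : g ^ 3 ∈ commutator G) :
    MonoidHom.transfer (Abelianization.of : H →* Abelianization H) g ^ 3 = 1 := by
  rw [← map_pow]
  exact Abelianization.commutator_subset_ker _ hg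

section transport

variable {G G' : Type*} [Group G] [Group G'] (e : G ≃* G')

theorem index_map_mulEquiv (H : Subgroup G) : (H.map e.toMonoidHom).index = H.index :=
  Subgroup.index_map_of_bijective e.bijective H

theorem transferKernel_map {H : Subgroup G} [H.Normal] [H.FiniteIndex] (hH : H.index = 3)
    [(H.map e.toMonoidHom).FiniteIndex] :
    transferKernel (H.map e.toMonoidHom) = (transferKernel H).map e.toMonoidHom := by
  have hn : (H.map e.toMonoidHom).Normal := ‹H.Normal›.map _ e.surjective
  have hH' : (H.map e.toMonoidHom).index = 3 := by rw [index_map_mulEquiv, hH]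
  have hmem (K : Subgroup G) (g : G) : e g ∈ K.map e.toMonoidHom ↔ g ∈ K :=
    Subgroup.mem_map_iff_mem e.injective
  have hcomm (g : G) : e g ∈ ⁅H.map e.toMonoidHom, H.map e.toMonoidHom⁆ ↔ g ∈ ⁅H, H⁆ := by
    rw [← Subgroup.map_commutator, hmem]
  obtain ⟨h, hh⟩ : ∃ h, h ∉ H := by
    by_contra! hall
    rw [(Subgroup.eq_top_iff' H).2 hall, Subgroup.index_top] at hH
    omega
  have key (g : G) : e g ∈ transferKernel (H.map e.toMonoidHom) ↔ g ∈ transferKernel H := by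
    by_cases hg : g ∈ H
    · rw [transferKernel, transferKernel, MonoidHom.mem_ker, MonoidHom.mem_ker,
        transfer_of_mem hH hh _ hg, transfer_of_mem hH' (h := e h) (by rwa [hmem]) _ ((hmem _ _).2 hg),
        abelianization_of_eq_one_iff, abelianization_of_eq_one_iff, ← hcomm]
      simp only [map_mul, map_inv]
    · rw [transferKernel, transferKernel, MonoidHom.mem_ker, MonoidHom.mem_ker,
        transfer_of_notMem hH hg, transfer_of_notMem hH' (h := e g) (by rwa [hmem]),
        abelianization_of_eq_one_iff, abelianization_of_eq_one_iff, ← hcomm, map_pow]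
  ext g'
  obtain ⟨g, rfl⟩ := e.surjective g'
  rw [key, hmem]

include e in
/-- The transfer kernel type is invariant under isomorphism. -/
theorem HasTKT.of_mulEquiv {κ : Fin 4 → Fin 5} (hn : ∀ K : Subgroup G, K.index = 3 → K.Normal)
    (h : HasTKT G κ) : HasTKT G' κ := by
  obtain ⟨H, hinj, hrange, hker⟩ := h
  refine ⟨fun i => (H i).map e.toMonoidHom,
    (Subgroup.map_injective e.injective).comp hinj, ?_, fun i => ?_⟩
  · ext K
    constructor
    · rintro ⟨i, rfl⟩
      have hi : (H i).index = 3 := hrange.subset ⟨i, rfl⟩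
      rw [Set.mem_ofPred_eq, index_map_mulEquiv, hi]
    · intro hK
      have hK' : (K.map e.symm.toMonoidHom).index = 3 := by rw [index_map_mulEquiv, hK]
      obtain ⟨i, hi⟩ := hrange.symm.subset hK'
      refine ⟨i, ?_⟩
      simp only [hi]
      rw [Subgroup.map_map]
      ext g
      simp
  · obtain ⟨_, hi⟩ := hker i
    have hidx : (H i).index = 3 := hrange.subset ⟨i, rfl⟩
    have := hn _ hidx
    have hfin : ((H i).map e.toMonoidHom).FiniteIndex :=
      ⟨by rw [index_map_mulEquiv, hidx]; decide⟩
    refine ⟨hfin, ?_⟩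
    rw [transferKernel_map e hidx, hi]
    generalize κ i = k
    refine Fin.cases ?_ (fun j => ?_) k
    · exact Subgroup.map_top_of_surjective _ e.surjective
    · rfl

end transport

/-! ### Maximal subgroups of the model and their commutator subgroups -/

theorem commutator_le_of_comm_mem {G : Type*} [Group G] {H K : Subgroup G}
    (h : ∀ a ∈ H, ∀ b ∈ H, comm a b ∈ K) : ⁅H, H⁆ ≤ K := by
  rw [Subgroup.commutator_le]
  intro a ha b hb
  simpa [comm, commutatorElement_def] using h _ (H.inv_mem ha) _ (H.inv_mem hb)

namespace Model

variable {c β : ℕ} {R : Type*} [CommRing R] (D : Uniserial c β R) (α : ℕ)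

/-- The homomorphism `a i + b j` to `𝔽₃`, where `i` and `j` are the exponents of `x` and `y`
modulo the commutator subgroup. -/
def functional (a b : ZMod 3) : Model D α →* Multiplicative (ZMod 3) where
  toFun g := .ofAdd (a * g.i + b * D.p₀ g.u)
  map_one' := by simp
  map_mul' g h := by
    rw [← ofAdd_add, mul_i, mul_p₀]
    congr 1
    ring

/-- The kernel of the homomorphism `a i + b j`, a maximal subgroup unless `a = b = 0`. -/
def maxSub (a b : ZMod 3) : Subgroup (Model D α) := (functional D α a b).ker

instance (a b : ZMod 3) : (maxSub D α a b).Normal := MonoidHom.normal_ker _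

variable {D α}

theorem mem_maxSub {a b : ZMod 3} {g : Model D α} :
    g ∈ maxSub D α a b ↔ a * g.i + b * D.p₀ g.u = 0 := Iff.rfl

theorem maxSub_zero : maxSub D α 0 0 = ⊤ := by
  ext g
  simp [mem_maxSub]

theorem maxSub_neg (a b : ZMod 3) : maxSub D α (-a) (-b) = maxSub D α a b := by
  ext g
  rw [mem_maxSub, mem_maxSub, neg_mul, neg_mul, ← neg_add, neg_eq_zero]

theorem functional_genX (a b : ZMod 3) : functional D α a b (genX D α) = .ofAdd a := by
  simp [functional, genX]

theorem functional_vec_one (a b : ZMod 3) : functional D α a b (vec D α 1 0) = .ofAdd b := by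
  simp [functional]

theorem genX_mem_maxSub {a b : ZMod 3} : genX D α ∈ maxSub D α a b ↔ a = 0 := by
  simp [mem_maxSub, genX]

theorem vec_one_mem_maxSub {a b : ZMod 3} : vec D α 1 0 ∈ maxSub D α a b ↔ b = 0 := by
  simp [mem_maxSub]

theorem index_maxSub {a b : ZMod 3} (h : ¬(a = 0 ∧ b = 0)) : (maxSub D α a b).index = 3 := by
  rw [maxSub, Subgroup.index_ker]
  have hp : (Nat.card (Multiplicative (ZMod 3))).Prime := by
    rw [Nat.card_congr Multiplicative.toAdd, Nat.card_zmod]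
    exact Nat.prime_three
  have : Fact (Nat.card (Multiplicative (ZMod 3))).Prime := ⟨hp⟩
  rcases (functional D α a b).range.eq_bot_or_eq_top_of_prime_card with hb | ht
  · rw [MonoidHom.range_eq_bot_iff] at hb
    refine absurd ⟨?_, ?_⟩ h
    · have h1 := functional_genX (D := D) (α := α) a b
      rw [hb] at h1
      exact (Multiplicative.ofAdd.injective h1).symm
    · have h1 := functional_vec_one (D := D) (α := α) a b
      rw [hb] at h1
      exact (Multiplicative.ofAdd.injective h1).symm
  · rw [ht, Subgroup.card_top, Nat.card_congr Multiplicative.toAdd, Nat.card_zmod]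

theorem normal_of_index_three (K : Subgroup (Model D α)) (hK : K.index = 3) : K.Normal := by
  refine Subgroup.normal_of_index_eq_minFac_card ?_
  rw [hK, card_eq, Nat.Prime.pow_minFac Nat.prime_three (by omega)]

/-- The subgroups of index `3` are the four kernels of non-trivial homomorphisms to `𝔽₃`. -/
theorem eq_maxSub_of_index (K : Subgroup (Model D α)) (hK : K.index = 3) :
    K = maxSub D α 1 0 ∨ K = maxSub D α 0 1 ∨ K = maxSub D α 1 1 ∨ K = maxSub D α 1 (-1) := by
  have hcases : ∀ a b : ZMod 3, ¬(a = 0 ∧ b = 0) → (a = 1 ∨ a = -1) ∧ b = 0 ∨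
      a = 0 ∧ (b = 1 ∨ b = -1) ∨ (a = 1 ∧ b = 1 ∨ a = -1 ∧ b = -1) ∨
      (a = 1 ∧ b = -1 ∨ a = -1 ∧ b = - -1) := by decide
  have hn := normal_of_index_three K hK
  have : Fact (Nat.Prime 3) := ⟨Nat.prime_three⟩
  let e : Model D α ⧸ K ≃* Multiplicative (ZMod 3) :=
    mulEquivOfPrimeCardEq (p := 3) hK (by
      rw [Nat.card_congr Multiplicative.toAdd, Nat.card_zmod])
  let χ : Model D α →* Multiplicative (ZMod 3) := e.toMonoidHom.comp (QuotientGroup.mk' K)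
  have hχ : K = χ.ker := by
    ext g
    simp [χ]
  obtain ⟨a, ha⟩ : ∃ a : ZMod 3, χ (genX D α) = .ofAdd a := ⟨_, rfl⟩
  obtain ⟨b, hb⟩ : ∃ b : ZMod 3, χ (vec D α 1 0) = .ofAdd b := ⟨_, rfl⟩
  have hF : χ = functional D α a b := by
    refine MonoidHom.eq_of_eqOn_dense (closure_eq_top D α) ?_
    rintro _ (rfl | rfl)
    · rw [ha, functional_genX]
    · rw [hb, functional_vec_one]
  have hKab : K = maxSub D α a b := by rw [hχ, hF, maxSub]
  have hab : ¬(a = 0 ∧ b = 0) := by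
    rintro ⟨rfl, rfl⟩
    rw [hKab, maxSub_zero, Subgroup.index_top] at hK
    omega
  rw [hKab]
  rcases hcases a b hab with ⟨rfl | rfl, rfl⟩ | ⟨rfl, rfl | rfl⟩ | (⟨rfl, rfl⟩ | ⟨rfl, rfl⟩) |
    (⟨rfl, rfl⟩ | ⟨rfl, rfl⟩)
  · exact Or.inl rfl
  · exact Or.inl (by rw [← neg_zero, maxSub_neg, neg_zero])
  · exact Or.inr (Or.inl rfl)
  · exact Or.inr (Or.inl (by
      have := maxSub_neg (D := D) (α := α) 0 1
      rwa [neg_zero] at this))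
  · exact Or.inr (Or.inr (Or.inl rfl))
  · exact Or.inr (Or.inr (Or.inl (maxSub_neg _ _)))
  · exact Or.inr (Or.inr (Or.inr rfl))
  · exact Or.inr (Or.inr (Or.inr (maxSub_neg _ _)))

theorem comm_eq (g h : Model D α) : comm g h =
    vec D α ((D.z h.i - 1) * g.u - (D.z g.i - 1) * h.u)
      ((g.i * D.p₀ h.u + D.p₁ h.u) * D.p₀ g.u - D.p₀ h.u * D.p₁ g.u
        - ((h.i * D.p₀ g.u + D.p₁ g.u) * D.p₀ h.u - D.p₀ g.u * D.p₁ h.u)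
        - (D.p₀ g.u + D.p₀ h.u) * (h.i * D.p₀ g.u - g.i * D.p₀ h.u)) := by
  have hc (i j : ZMod 3) : carry i j = carry j i := by
    revert i j
    decide
  rw [comm_eq_iff]
  ext
  · simp [add_comm]
  · simp only [mul_u, mul_i, vec_i, vec_u, D.z_zero, carry_zero_right, hc g.i h.i]
    push_cast
    ring
  · rw [mul_t, mul_t (h * g), mul_t h g, mul_p₀, mul_p₁]
    simp only [vec_i, vec_u, vec_t, map_sub, map_mul, D.p₁_mul, D.p₀_z, D.p₁_z, map_one, D.p₁_one]
    ring

variable (D α)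

/-- The subgroup of the model given by an additive subgroup of `R × 𝔽₃` on which the form `ω`
vanishes because its elements are `0` modulo the maximal ideal. -/
def vecSub (A : AddSubgroup (R × ZMod 3)) (hA : ∀ p ∈ A, D.p₀ p.1 = 0) : Subgroup (Model D α) where
  carrier := {g | g.i = 0 ∧ (g.u, g.t) ∈ A}
  one_mem' := ⟨rfl, A.zero_mem⟩
  mul_mem' := by
    rintro g h ⟨hg, hg'⟩ ⟨hh, hh'⟩
    rw [eq_vec hg, eq_vec hh, vec_mul_vec, D.ω_eq_zero (hA _ hg') (hA _ hh'), sub_zero]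
    exact ⟨rfl, A.add_mem hg' hh'⟩
  inv_mem' := by
    rintro g ⟨hg, hg'⟩
    rw [eq_vec hg, vec_inv]
    exact ⟨rfl, A.neg_mem hg'⟩

variable {D α}

theorem vec_mem_vecSub {A : AddSubgroup (R × ZMod 3)} {hA : ∀ p ∈ A, D.p₀ p.1 = 0} {u : R}
    {t : ZMod 3} : vec D α u t ∈ vecSub D α A hA ↔ (u, t) ∈ A :=
  and_iff_right rfl

/-! ### The transfer to `⟨y, G'⟩` -/

theorem commutator_maxSub_one_zero {u : R} {t : ZMod 3}
    (h : vec D α u t ∈ ⁅maxSub D α 1 0, maxSub D α 1 0⁆) : u = 0 := by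
  have hle : ⁅maxSub D α 1 0, maxSub D α 1 0⁆ ≤
      vecSub D α (AddSubgroup.prod ⊥ ⊤) (by
        rintro ⟨u, t⟩ ⟨hu, -⟩
        rw [show u = 0 from hu, map_zero]) := by
    refine commutator_le_of_comm_mem fun g hg h hh => ?_
    rw [mem_maxSub] at hg hh
    simp only [one_mul, zero_mul, add_zero] at hg hh
    rw [comm_eq, vec_mem_vecSub, hg, hh, D.z_zero]
    refine ⟨?_, trivial⟩
    change _ = (0 : R)
    ring
  exact (vec_mem_vecSub.1 (hle h)).1

theorem vec_zero_mem_commutator_maxSub (t : ZMod 3) :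
    vec D α 0 t ∈ ⁅maxSub D α 1 0, maxSub D α 1 0⁆ := by
  have h : comm (vec D α (t.val * D.X) 0) (vec D α 1 0) = vec D α 0 t := by
    rw [comm_vec_vec, ω, D.p₁_mul, map_mul, D.p₁_one, D.p₀_X, D.p₁_X, map_natCast, map_one,
      ZMod.natCast_zmod_val]
    congr 1
    ring
  rw [← h]
  exact comm_mem_commutator (by simp [mem_maxSub]) (by simp [mem_maxSub])

theorem pow_three_genX : genX D α ^ 3 = vec D α (α * D.X ^ (c - 1)) 0 := by
  rw [eq_vec (pow_three_i (genX D α)), pow_three_u (by exact one_ne_zero), pow_three_t]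
  simp [genX, ZMod.val_one]

theorem of_vec_eq {H : Subgroup (Model D α)} {u : R} {t : ZMod 3} (h : vec D α u t ∈ H)
    (h' : vec D α u 0 ∈ H) (ht : vec D α 0 t ∈ ⁅H, H⁆) :
    (Abelianization.of ⟨vec D α u t, h⟩ : Abelianization H) = Abelianization.of ⟨vec D α u 0, h'⟩ := by
  rw [← inv_mul_eq_one, ← map_inv, ← map_mul]
  have e : vec D α (-u) (-t) * vec D α u 0 = (vec D α 0 t)⁻¹ := by
    rw [vec_mul_vec, vec_inv, ω, map_neg, map_neg]
    congr 1 <;> ring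
  have h1 := inv_mem ht
  rw [← e, ← vec_inv] at h1
  exact (abelianization_of_eq_one_iff (H.mul_mem (H.inv_mem h) h')).2 h1

theorem transferKernel_maxSub_one_zero [(maxSub D α 1 0).FiniteIndex] :
    transferKernel (maxSub D α 1 0) = maxSub D α α β := by
  have hidx : (maxSub D α 1 0).index = 3 := index_maxSub (by decide)
  have hx : genX D α ∉ maxSub D α 1 0 := by rw [genX_mem_maxSub]; decide
  have hy : vec D α 1 0 ∈ maxSub D α 1 0 := by rw [vec_one_mem_maxSub]
  have hmem (u : R) (t : ZMod 3) : vec D α u t ∈ maxSub D α 1 0 := by simp [mem_maxSub]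
  let z : Abelianization (maxSub D α 1 0) := Abelianization.of ⟨vec D α (D.X ^ (c - 1)) 0, hmem _ _⟩
  have hzpow (n : ℕ) : z ^ n = Abelianization.of ⟨vec D α (n * D.X ^ (c - 1)) 0, hmem _ _⟩ := by
    rw [← map_pow]
    exact congrArg _ (Subtype.ext ((vec_pow _ _ n).trans (by rw [mul_zero])))
  refine transferKernel_eq_ker (closure_eq_top D α) (functional D α α β) (z := z) ?_ ?_
    (functional_genX _ _) (functional_vec_one _ _) ?_ ?_
  · intro h
    exact D.X_pow_pred (commutator_maxSub_one_zero ((abelianization_of_eq_one_iff _).1 h))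
  · rw [hzpow, abelianization_of_eq_one_iff]
    push_cast
    rw [D.three_mul_X_pow]
    exact one_mem _
  · rw [transfer_of_notMem hidx hx, hzpow]
    congr 1
    ext1
    exact pow_three_genX
  · -- the product of the conjugates of `y` is `1 + ζ + ζ² = β X ^ (c - 1)`, up to a power of `t₃`
    have h1 (u : R) (t : ZMod 3) : (genX D α)⁻¹ * vec D α u t * genX D α =
        vec D α (D.z 1 * u) t := by
      rw [mul_assoc, vec_mul (map_zero _) (map_zero _), inv_mul_cancel_left]
      rfl
    rw [transfer_of_mem hidx hx _ hy, hzpow, ← of_vec_eq (hmem _ _) (hmem _ _)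
      (vec_zero_mem_commutator_maxSub
        (0 + 0 - D.ω 1 (D.z 1) + 0 - D.ω (1 + D.z 1) (D.z 1 * D.z 1)))]
    congr 1
    ext1
    simp only [h1, vec_mul_vec, mul_one]
    congr 1
    rw [← D.z_sum (a := 1) (by decide)]
    ring

/-! ### The transfer to `⟨x, G'⟩` -/

theorem commutator_maxSub_zero_one {g : Model D α}
    (h : g ∈ ⁅maxSub D α 0 1, maxSub D α 0 1⁆) : g.t = 0 := by
  have hle : ⁅maxSub D α 0 1, maxSub D α 0 1⁆ ≤
      vecSub D α (AddSubgroup.prod (D.p₀ : R →+ ZMod 3).ker ⊥) (by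
        rintro ⟨u, t⟩ ⟨hu, -⟩
        exact hu) := by
    refine commutator_le_of_comm_mem fun g hg h hh => ?_
    rw [mem_maxSub] at hg hh
    simp only [one_mul, zero_mul, zero_add] at hg hh
    rw [comm_eq, vec_mem_vecSub, hg, hh]
    refine ⟨?_, ?_⟩
    · change D.p₀ _ = 0
      rw [map_sub, map_mul, map_mul, hg, hh]
      ring
    · change _ = (0 : ZMod 3)
      ring
  exact (hle h).2.2

theorem pow_three_vec_one : vec D α 1 0 ^ 3 =
    vec D α (D.X * (D.X * (2 + D.X + β * D.X ^ (c - 3)))) 0 := by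
  have hc := D.five_le
  rw [vec_pow, mul_zero]
  congr 1
  have h := D.three_eq (a := 1) (by decide)
  rw [D.z_one, add_sub_cancel_left, show c - 1 = (c - 3) + 1 + 1 by omega, pow_succ, pow_succ] at h
  push_cast
  linear_combination h

theorem pow_three_genX' : genX D α ^ 3 = vec D α (D.X * (D.X * (α * D.X ^ (c - 3)))) 0 := by
  have hc := D.five_le
  rw [pow_three_genX, show c - 1 = (c - 3) + 1 + 1 by omega, pow_succ, pow_succ]
  congr 1
  ring

theorem transferKernel_maxSub_zero_one [(maxSub D α 0 1).FiniteIndex] :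
    transferKernel (maxSub D α 0 1) = maxSub D α 1 0 := by
  have hidx : (maxSub D α 0 1).index = 3 := index_maxSub (by decide)
  have hx : genX D α ∈ maxSub D α 0 1 := by rw [genX_mem_maxSub]
  have hy : vec D α 1 0 ∉ maxSub D α 0 1 := by rw [vec_one_mem_maxSub]; decide
  refine transferKernel_eq_ker (closure_eq_top D α) (functional D α 1 0)
    (z := MonoidHom.transfer Abelianization.of (genX D α)) (a := 1) (b := 0) ?_
    (transfer_pow_three_eq_one ?_) (by simp [functional_genX]) (by simp [functional_vec_one])
    (pow_one _).symm ?_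
  · rw [transfer_of_mem hidx hy _ hx, Ne, abelianization_of_eq_one_iff]
    intro h
    have ht := commutator_maxSub_zero_one h
    have h1 : (vec D α 1 0)⁻¹ = vec D α (-1) 0 := by rw [vec_inv, neg_zero]
    rw [h1] at ht
    simp only [mul_t, mul_p₀, mul_p₁, mul_i, vec_i, vec_u, vec_t, genX, map_zero, map_one, map_neg,
      D.p₁_one] at ht
    revert ht
    decide
  · have h := (stdSys D α).pow_x
    rw [stdSys_x] at h
    rw [h]
    exact pow_mem ((stdSys D α).s_mem_commutator (by have := D.five_le; omega)) _
  · rw [transfer_of_notMem hidx hy, pow_zero, abelianization_of_eq_one_iff, pow_three_vec_one]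
    have h : comm (vec D α (D.X * (2 + D.X + β * D.X ^ (c - 3))) 0) (genX D α) =
        vec D α (D.X * (D.X * (2 + D.X + β * D.X ^ (c - 3)))) 0 := by
      rw [comm_vec (map_zero _) (map_zero _), map_mul, D.p₀_X]
      congr 1
      · rw [show (genX D α).i = 1 from rfl, D.z_one, add_sub_cancel_left]
      · ring
    rw [← h]
    exact comm_mem_commutator (by simp [mem_maxSub, D.p₀_X]) hx

/-! ### The transfer to the two remaining maximal subgroups -/

/-- The commutator subgroup of the kernel of `i + δ j` is contained in the group of all
`(0, X² r, -δ r)`. -/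
theorem commutator_maxSub_one {δ : ZMod 3} (hδ : δ ≠ 0) {u : R} {t : ZMod 3}
    (h : vec D α u t ∈ ⁅maxSub D α 1 δ, maxSub D α 1 δ⁆) :
    ∃ r, D.X * (D.X * r) = u ∧ -δ * D.p₀ r = t := by
  have key (a b a' b' : ZMod 3) : -δ * (-(δ * b) * a' + (-(δ * b) - (-(δ * b)) ^ 2) * a -
      (-(δ * a) * b' + (-(δ * a) - (-(δ * a)) ^ 2) * b)) = (-(δ * a) * b + b') * a - b * a' -
      ((-(δ * b) * a + a') * b - a * b') - (a + b) * (-(δ * b) * a - -(δ * a) * b) := by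
    clear h
    revert δ a b a' b'
    decide
  let f : R →+ R × ZMod 3 :=
    ((AddMonoidHom.mulLeft D.X).comp (AddMonoidHom.mulLeft D.X)).prod
      ((AddMonoidHom.mulLeft (-δ)).comp (D.p₀ : R →+ ZMod 3))
  have hle : ⁅maxSub D α 1 δ, maxSub D α 1 δ⁆ ≤
      vecSub D α f.range (by
        rintro _ ⟨r, rfl⟩
        change D.p₀ (D.X * (D.X * r)) = 0
        rw [map_mul, D.p₀_X, zero_mul]) := by
    refine commutator_le_of_comm_mem fun g hg h hh => ?_
    rw [mem_maxSub] at hg hh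
    obtain ⟨q, hq, hq₀, hq₁⟩ := D.exists_z_sub_one' g.i
    obtain ⟨q', hq', hq₀', hq₁'⟩ := D.exists_z_sub_one' h.i
    obtain ⟨r, hr⟩ := D.exists_X_mul (u := q' * g.u - q * h.u) (by
      rw [map_sub, map_mul, map_mul, hq₀, hq₀']
      linear_combination D.p₀ g.u * hh - D.p₀ h.u * hg)
    have hr₁ := congrArg D.p₁ hr
    rw [map_sub, D.p₁_mul, D.p₁_mul, D.p₁_mul, D.p₀_X, D.p₁_X, hq₀, hq₀', hq₁, hq₁', zero_mul,
      zero_add, one_mul] at hr₁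
    rw [comm_eq, vec_mem_vecSub, hq, hq']
    refine ⟨r, Prod.ext ?_ ?_⟩
    · change D.X * (D.X * r) = _
      rw [← hr]
      ring
    · change -δ * D.p₀ r = _
      rw [← hr₁]
      generalize D.p₀ g.u = a at *
      generalize D.p₀ h.u = b at *
      obtain hi : g.i = -(δ * a) := by linear_combination hg
      obtain hi' : h.i = -(δ * b) := by linear_combination hh
      rw [hi, hi']
      exact key _ _ _ _
  obtain ⟨r, hr⟩ := vec_mem_vecSub.1 (hle h)
  exact ⟨r, congrArg Prod.fst hr, congrArg Prod.snd hr⟩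

theorem vec_mem_commutator_maxSub_one {δ : ZMod 3} (hδ : δ ≠ 0) (r : R) :
    vec D α (D.X * (D.X * r)) (-δ * D.p₀ r) ∈ ⁅maxSub D α 1 δ, maxSub D α 1 δ⁆ := by
  let k : Model D α := ⟨1, ((-δ).val : R), 0⟩
  have hδ2 : δ ^ 2 = 1 := by
    revert δ
    decide
  have hk : D.p₀ k.u = -δ := by
    rw [show D.p₀ k.u = (((-δ).val : ℕ) : ZMod 3) from map_natCast _ _, ZMod.natCast_zmod_val]
  have h : comm (vec D α (D.X * r) 0) k = vec D α (D.X * (D.X * r)) (-δ * D.p₀ r) := by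
    rw [comm_vec_left, hk, D.p₁_mul, map_mul, D.p₀_X, D.p₁_X, show k.i = 1 from rfl, D.z_one]
    congr 1 <;> ring
  rw [← h]
  refine comm_mem_commutator (by simp [mem_maxSub, D.p₀_X]) ?_
  rw [mem_maxSub, hk, show k.i = 1 from rfl]
  linear_combination -hδ2

theorem transferKernel_maxSub_one {δ : ZMod 3} (hδ : δ ≠ 0) [(maxSub D α 1 δ).FiniteIndex] :
    transferKernel (maxSub D α 1 δ) = maxSub D α 0 1 := by
  have hc := D.five_le
  have hidx : (maxSub D α 1 δ).index = 3 := index_maxSub (by simp)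
  have hx : genX D α ∉ maxSub D α 1 δ := by rw [genX_mem_maxSub]; decide
  have hy : vec D α 1 0 ∉ maxSub D α 1 δ := by rwa [vec_one_mem_maxSub]
  refine transferKernel_eq_ker (closure_eq_top D α) (functional D α 0 1)
    (z := MonoidHom.transfer Abelianization.of (vec D α 1 0)) (a := 0) (b := 1) ?_
    (transfer_pow_three_eq_one ?_) (by simp [functional_genX]) (by simp [functional_vec_one])
    ?_ (pow_one _).symm
  · rw [transfer_of_notMem hidx hy, Ne, abelianization_of_eq_one_iff, pow_three_vec_one]
    intro h
    obtain ⟨r, hr, hr'⟩ := commutator_maxSub_one hδ h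
    have h1 : r * D.X ^ (c - 1) = (2 + D.X + β * D.X ^ (c - 3)) * D.X ^ (c - 1) := by
      have e : D.X ^ (c - 1) = D.X ^ (c - 3) * (D.X * D.X) := by
        rw [← sq, ← pow_add]
        congr 1
        omega
      rw [e]
      linear_combination D.X ^ (c - 3) * hr
    rw [D.mul_X_pow_inj, map_add, map_add, map_mul, D.p₀_X, D.p₀_X_pow (by omega), map_ofNat] at h1
    rw [h1, mul_eq_zero, neg_eq_zero] at hr'
    rcases hr' with h2 | h2
    · exact hδ h2
    · revert h2
      rw [mul_zero, add_zero, add_zero]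
      decide
  · have h := (stdSys D α).pow_y
    rw [stdSys_y] at h
    rw [h]
    exact mul_mem (mul_mem (pow_mem ((stdSys D α).s_mem_commutator (by omega)) _)
      ((stdSys D α).s_mem_commutator (by omega)))
      (pow_mem ((stdSys D α).s_mem_commutator (by omega)) _)
  · rw [transfer_of_notMem hidx hx, pow_zero, abelianization_of_eq_one_iff, pow_three_genX']
    have h := vec_mem_commutator_maxSub_one (D := D) (α := α) hδ (α * D.X ^ (c - 3))
    rwa [map_mul, D.p₀_X_pow (by omega), mul_zero, mul_zero] at h

/-- The four maximal subgroups, in the order of the transfer kernel types; the third is the kernel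
of `i + δ j`. -/
def maxSubs (D : Uniserial c β R) (α : ℕ) (δ : ZMod 3) : Fin 4 → Subgroup (Model D α) :=
  ![maxSub D α 1 0, maxSub D α 0 1, maxSub D α 1 δ, maxSub D α 1 (-δ)]

theorem maxSubs_injective {δ : ZMod 3} (hδ : δ ≠ 0) : Function.Injective (maxSubs D α δ) := by
  have key {a b a' b' : ZMod 3} (h : maxSub D α a b = maxSub D α a' b') :
      a * b' = a' * b := by
    have h1 : (⟨b, ((-a).val : R), 0⟩ : Model D α) ∈ maxSub D α a b := by
      rw [mem_maxSub, map_natCast, ZMod.natCast_zmod_val]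
      ring
    rw [h, mem_maxSub, map_natCast, ZMod.natCast_zmod_val] at h1
    linear_combination -h1
  intro k l hkl
  have h2 : (1 : ZMod 3) * -δ = 1 * δ → False := by
    clear hkl
    revert δ
    decide
  have h2' : (1 : ZMod 3) * δ = 1 * -δ → False := fun h => h2 h.symm
  fin_cases k <;> fin_cases l <;> first
    | rfl
    | exact (h2 (key hkl)).elim
    | exact (h2' (key hkl)).elim
    | (have h := key hkl
       clear h2 h2'
       simp_all)

theorem range_maxSubs {δ : ZMod 3} (hδ : δ ≠ 0) :
    Set.range (maxSubs D α δ) = {K | K.index = 3} := by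
  ext K
  constructor
  · rintro ⟨k, rfl⟩
    fin_cases k
    · exact index_maxSub (by decide)
    · exact index_maxSub (by decide)
    · exact index_maxSub (by simp)
    · exact index_maxSub (by simp)
  · intro hK
    obtain hδ' | hδ' : δ = 1 ∨ δ = -1 := by
      revert δ
      decide
    all_goals
      subst hδ'
      rcases eq_maxSub_of_index K hK with rfl | rfl | rfl | rfl
    · exact ⟨0, rfl⟩
    · exact ⟨1, rfl⟩
    · exact ⟨2, rfl⟩
    · exact ⟨3, rfl⟩
    · exact ⟨0, rfl⟩
    · exact ⟨1, rfl⟩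
    · exact ⟨3, by rw [← neg_neg (1 : ZMod 3)]; rfl⟩
    · exact ⟨2, rfl⟩

theorem hasTKT_of_eq {δ : ZMod 3} (hδ : δ ≠ 0) (k : Fin 5)
    (hk : (Fin.cons ⊤ (maxSubs D α δ) : Fin 5 → Subgroup (Model D α)) k = maxSub D α α β) :
    HasTKT (Model D α) ![k, 1, 2, 2] := by
  refine ⟨maxSubs D α δ, maxSubs_injective hδ, range_maxSubs hδ, fun l => ?_⟩
  have hidx : (maxSubs D α δ l).index = 3 := (range_maxSubs hδ).subset ⟨l, rfl⟩
  have hfin : (maxSubs D α δ l).FiniteIndex := ⟨by rw [hidx]; decide⟩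
  refine ⟨hfin, ?_⟩
  fin_cases l
  · have : (maxSub D α 1 0).FiniteIndex := hfin
    exact transferKernel_maxSub_one_zero.trans hk.symm
  · have : (maxSub D α 0 1).FiniteIndex := hfin
    exact transferKernel_maxSub_zero_one
  · have : (maxSub D α 1 δ).FiniteIndex := hfin
    exact transferKernel_maxSub_one hδ
  · have : (maxSub D α 1 (-δ)).FiniteIndex := hfin
    exact transferKernel_maxSub_one (neg_ne_zero.2 hδ)

end Model

theorem QGroup.hasTKT {c : ℕ} (hc : 5 ≤ c) (α : Fin 2) (β : Fin 3) :
    HasTKT (QGroup c α β) (tkt α β) := by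
  refine HasTKT.of_mulEquiv (QGroup.equivModel hc α β).symm Model.normal_of_index_three ?_
  fin_cases α <;> fin_cases β
  · exact Model.hasTKT_of_eq (δ := 1) one_ne_zero 0 Model.maxSub_zero.symm
  · exact Model.hasTKT_of_eq (δ := 1) one_ne_zero 2 rfl
  · exact Model.hasTKT_of_eq (δ := 1) one_ne_zero 2 (Model.maxSub_neg 0 (-1))
  · exact Model.hasTKT_of_eq (δ := 1) one_ne_zero 1 rfl
  · exact Model.hasTKT_of_eq (δ := 1) one_ne_zero 3 rfl
  · exact Model.hasTKT_of_eq (δ := 2) (by decide) 3 rfl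

end QTree

theorem mainTheorem7 (c : ℕ) (hc : 5 ≤ c) :
    -- the six groups, their invariants, their generators, and their types
    (∀ (α : Fin 2) (β : Fin 3),
      Nat.card (QTree.QGroup c α β) = 3 ^ (c + 2) ∧
      QTree.HasClass (QTree.QGroup c α β) c ∧
      QTree.HasCoclass 3 (QTree.QGroup c α β) 2 ∧
      QTree.IsMetabelian (QTree.QGroup c α β) ∧
      QTree.IsDescendant (QTree.QGroup c α β) QTree.Root ∧
      Subgroup.closure {QTree.QGroup.mk α β (QTree.wx c), QTree.QGroup.mk α β (QTree.wy c)} = ⊤ ∧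
      QTree.QGroup.mk α β (QTree.wt c) ∈ commutator (QTree.QGroup c α β) ∧
      (∀ j, 2 ≤ j → j ≤ c →
        QTree.QGroup.mk α β (QTree.ws c j) ∈ commutator (QTree.QGroup c α β)) ∧
      QTree.HasTKT (QTree.QGroup c α β) (QTree.tkt α β)) ∧
    -- the groups with `α = β = 0` form the mainline
    Nonempty (QTree.QGroup (c + 1) 0 0 ⧸
      (⊤ : Subgroup (QTree.QGroup (c + 1) 0 0)).lowerCentralSeries c ≃* QTree.QGroup c 0 0) ∧
    -- odd class
    (Odd c →
      (∀ (α α' : Fin 2) (β β' : Fin 3),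
        Nonempty (QTree.QGroup c α β ≃* QTree.QGroup c α' β') → α = α' ∧ β = β') ∧
      ∀ (α : Fin 2) (β : Fin 3), QTree.IsSigmaGroup (QTree.QGroup c α β)) ∧
    -- even class
    (Even c →
      (∀ (α α' : Fin 2) (β β' : Fin 3),
        Nonempty (QTree.QGroup c α β ≃* QTree.QGroup c α' β') ↔
          QTree.tkt α β = QTree.tkt α' β') ∧
      ∀ (α : Fin 2) (β : Fin 3),
        QTree.IsSigmaGroup (QTree.QGroup c α β) ↔ α = 0 ∧ β = 0) := by
  exact ⟨fun α β => ⟨QTree.QGroup.card_eq hc α β, QTree.QGroup.hasClass hc α β,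
      QTree.QGroup.hasCoclass hc α β, QTree.QGroup.isMetabelian hc α β,
      QTree.QGroup.isDescendant hc α β, QTree.QGroup.closure_eq_top α β hc,
      (QTree.QGroup.sys α β hc).t_mem_commutator,
      fun _ hj _ => (QTree.QGroup.sys α β hc).s_mem_commutator hj, QTree.QGroup.hasTKT hc α β⟩,
    QTree.QGroup.mainline hc,
    fun ho => ⟨fun _ _ _ _ ⟨e⟩ => QTree.QGroup.eq_of_mulEquiv_of_odd hc ho e,
      QTree.QGroup.isSigmaGroup_of_odd hc ho⟩,
    fun he => ⟨QTree.QGroup.nonempty_mulEquiv_iff_of_even hc he,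
      QTree.QGroup.isSigmaGroup_iff_of_even hc he⟩⟩
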